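/- **Notation.** Let $l$ be a positive integer, $k\in\mathbb Z$, $I=I^*\sqcup I_*$ with $I^*=\{1^*,\dots,l^*\}$ and $I_*=\{1_*,\dots,l_*\}$. A link is an unordered pair $(\alpha,\beta)$ of distinct elements of $I$; for each link let $X^{\alpha\beta}=X^{\beta\alpha}$ be an indeterminate. For a set $L$ of pairwise disjoint links let $\overline L\subseteq I$ be the union of its members and $X^L=\prod_{(\alpha,\beta)\in L}X^{\alpha\beta}$. A polynomial is *homogeneous with underlying set $I$* if it is a linear combination of the monomials $X^L$ with $\overline L=I$. Such a $\mathfrak P$ with complex coefficients is *pluri-harmonic for $\Delta^*(d)$ and $\Delta_*(d)$* if $$\Big(d\,\frac{\partial}{\partial X^{\alpha\beta}}+\sum_{\gamma,\delta\in I\setminus\{\alpha,\beta\},\ \gamma\ne\delta}X^{\gamma\delta}\frac{\partial^2}{\partial X^{\alpha\gamma}\,\partial X^{\beta\delta}}\Big)\mathfrak P=0$$ for all $\alpha\neq\beta$ in $I^*$ and all $\alpha\ne\beta$ in $I_*$. For positive integers $p,q$ let $e^{(a^*)}=(e_1^{(a^*)},\dots,e_p^{(a^*)},0,\dots,0)$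 and $e^{(b_*)}=(0,\dots,0,e_1^{(b_*)},\dots,e_q^{(b_*)})$ be row vectors of length $p+q$ in indeterminates. For a symmetric matrix $A$ of size $p+q$ put $A^{\alpha\beta}=e^{(\alpha)}A\,{}^t e^{(\beta)}$, and let $\mathfrak P(A)$ be the result of substituting $A^{\alpha\beta}$ for $X^{\alpha\beta}$. It is a polynomial in the $e$'s, linear in each $e^{(\alpha)}$, hence an element of $T^l(\mathbb C^p)\otimes T^l(\mathbb C^q)$. Likewise $\mathfrak P(\partial)$ is the differential operator obtained from the matrix $\partial=\big(\tfrac{1+\delta_{\mu\nu}}2\tfrac{\partial}{\partial z_{\mu\nu}}\big)_{\mu,\nu}$ of Wirtinger derivatives in the entries of a symmetric matrix $\mathfrak Z=(z_{\mu\nu})$, where $\delta_{\mu\nu}$ is Kronecker's delta. Let $\mathfrak H_n$ be the Siegel upper half space of degree $n$. For $g=\begin{pmatrix}\mathfrak A&\mathfrak B\\ \mathfrak C&\mathfrak D\end{pmatrix}\in Sp(p+q,\mathbb R)$ (a group of matrices of size $2(p+q)$) and $\mathfrak Z\in\mathfrak H_{p+q}$ put $$\delta=\det(\mathfrak C\mathfrak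 Z+\mathfrak D),\quad \Delta=(\mathfrak C\mathfrak Z+\mathfrak D)^{-1}\mathfrak C,\quad \varepsilon=\det(\Im\mathfrak Z),\quad \mathrm E=\tfrac1{2i}(\Im\mathfrak Z)^{-1}.$$ **Proposition 4.2.** Let $\mathfrak P$ be homogeneous with underlying set $I$ and pluri-harmonic for $\Delta^*(2k)$ and $\Delta_*(2k)$. Then there is a polynomial $\mathfrak Q(X,s)$, homogeneous in $X$ with underlying set $I$ and with coefficients that are polynomials in $s$, such that for all $p,q$, all $s\in\mathbb C$, all $g\in Sp(p+q,\mathbb R)$ and all $Z\in\mathfrak H_p$, $W\in\mathfrak H_q$, $$\big(\mathfrak P(\partial)(\delta^{-k}|\delta|^{-2s}\varepsilon^s)\big)\big|_{\mathfrak Z=\mathfrak Z_0}=\big(\delta^{-k}|\delta|^{-2s}\varepsilon^s\,\mathfrak Q(\Delta-\mathrm E,s)\big)\big|_{\mathfrak Z=\mathfrak Z_0},\qquad \mathfrak Z_0=\begin{pmatrix}Z&0\\0&W\end{pmatrix}.$$ -/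

import Mathlib

open scoped Matrix

namespace SiegelPullback

noncomputable section

/-! ### Links and homogeneous polynomials -/

section Links

variable {ι : Type*}

/-- A finite set of links: its members are unordered pairs of distinct indices,
and no index occurs in two different members. -/
def IsLinkSet (L : Finset (Sym2 ι)) : Prop :=
  (∀ u ∈ L, ¬ u.IsDiag) ∧ ∀ u ∈ L, ∀ v ∈ L, ∀ α, α ∈ u → α ∈ v → u = v

/-- The set of all indices that occur in `L`. -/
def underlying (L : Finset (Sym2 ι)) : Set ι := {α | ∃ u ∈ L, α ∈ u}

/-- The monomial `X^L`, the product of the indeterminates `X^{αβ}` over the links of `L`. -/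
def linkMonomial (R : Type*) [CommRing R] (L : Finset (Sym2 ι)) : MvPolynomial (Sym2 ι) R :=
  ∏ u ∈ L, MvPolynomial.X u

/-- `P` is a homogeneous polynomial with underlying set `J`: a linear combination of the monomials
`X^L`, where `L` runs over the sets of links with underlying set `J`. Such a `P` involves only
indeterminates `X^{αβ}` with `α ≠ β`. -/
def IsHomogeneousOn {R : Type*} [CommRing R] (J : Set ι) (P : MvPolynomial (Sym2 ι) R) : Prop :=
  P ∈ Submodule.span R {M | ∃ L, IsLinkSet L ∧ underlying L = J ∧ M = linkMonomial R L}

/-- The formal mixed Laplacian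
`Δ^{αβ}(d) = d ∂/∂X^{αβ} + ∑_{γ,δ} X^{γδ} ∂²/∂X^{αγ}∂X^{βδ}` (`α ≠ β`).
If `X^{αβ} = ∑_κ y_{ακ} y_{βκ}` with vectors `y_α` of length `d`, then on polynomials that are linear
in each `y_α` it is the operator `∑_κ ∂²/∂y_{ακ}∂y_{βκ}`. In a homogeneous polynomial each index
occurs in exactly one factor of each monomial, so only the terms for which
`α, β, γ, δ` are distinct contribute to the sum. -/
def laplacian [Fintype ι] (d : ℂ) (α β : ι) (P : MvPolynomial (Sym2 ι) ℂ) :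
    MvPolynomial (Sym2 ι) ℂ :=
  d • MvPolynomial.pderiv s(α, β) P +
    ∑ γ, ∑ δ, MvPolynomial.X s(γ, δ) *
      MvPolynomial.pderiv s(α, γ) (MvPolynomial.pderiv s(β, δ) P)

/-- Pluri-harmonicity for `Δ^*(d)` and `Δ_*(d)`. The index set is
`I = I^* ∪ I_*` with `I^* = {1^*, …, l^*}` (the left summand) and `I_* = {1_*, …, l_*}`
(the right summand); `P` is annihilated by the Laplacians of all pairs inside `I^*` and
of all pairs inside `I_*`. -/
def IsPluriharmonic {l : ℕ} (d : ℂ) (P : MvPolynomial (Sym2 (Fin l ⊕ Fin l)) ℂ) : Prop :=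
  (∀ a b : Fin l, a ≠ b → laplacian d (Sum.inl a) (Sum.inl b) P = 0) ∧
  (∀ a b : Fin l, a ≠ b → laplacian d (Sum.inr a) (Sum.inr b) P = 0)

end Links

/-! ### The Siegel upper half space and the functions `δ`, `Δ`, `ε`, `E` -/

section Siegel

variable {n : Type*} [Fintype n] [DecidableEq n]

/-- The Siegel upper half space: symmetric complex matrices with positive definite imaginary
part. -/
def siegelUpperHalfSpace (n : Type*) [Fintype n] : Set (Matrix n n ℂ) :=
  {Z | Z.IsSymm ∧ (Z.map Complex.im).PosDef}

/-- `CZ + D` for `g = (A B; C D)`. -/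
def autoFactor (g : Matrix (n ⊕ n) (n ⊕ n) ℝ) (Z : Matrix n n ℂ) : Matrix n n ℂ :=
  g.toBlocks₂₁.map Complex.ofReal * Z + g.toBlocks₂₂.map Complex.ofReal

/-- `δ(g, Z) = det (CZ + D)`. -/
def smallDelta (g : Matrix (n ⊕ n) (n ⊕ n) ℝ) (Z : Matrix n n ℂ) : ℂ := (autoFactor g Z).det

/-- `Δ(g, Z) = (CZ + D)⁻¹ C`. -/
def bigDelta (g : Matrix (n ⊕ n) (n ⊕ n) ℝ) (Z : Matrix n n ℂ) : Matrix n n ℂ :=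
  (autoFactor g Z)⁻¹ * g.toBlocks₂₁.map Complex.ofReal

/-- `ε(Z) = det (Im Z)`. -/
def smallEps (Z : Matrix n n ℂ) : ℝ := (Z.map Complex.im).det

/-- `E(Z) = (1 / 2i) (Im Z)⁻¹`. -/
def bigE (Z : Matrix n n ℂ) : Matrix n n ℂ :=
  (1 / (2 * Complex.I)) • ((Z.map Complex.im)⁻¹).map Complex.ofReal

/-- The function `δ^{-k} |δ|^{-2s} ε^s` of `Z`. -/
def weightFun (k : ℤ) (s : ℂ) (g : Matrix (n ⊕ n) (n ⊕ n) ℝ) (Z : Matrix n n ℂ) : ℂ :=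
  smallDelta g Z ^ (-k) * ((‖smallDelta g Z‖ : ℝ) : ℂ) ^ (-2 * s) * ((smallEps Z : ℝ) : ℂ) ^ s

theorem bigDelta_isSymm {g : Matrix (n ⊕ n) (n ⊕ n) ℝ} (hg : g ∈ Matrix.symplecticGroup n ℝ)
    {Z : Matrix n n ℂ} (hZ : Z.IsSymm) : (bigDelta g Z).IsSymm := by
  have hCD : g.toBlocks₂₁ * g.toBlocks₂₂ᵀ = g.toBlocks₂₂ * g.toBlocks₂₁ᵀ := by
    have h := SymplecticGroup.mem_iff.mp hg
    rw [← Matrix.fromBlocks_toBlocks g, Matrix.J, Matrix.fromBlocks_transpose,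
      Matrix.fromBlocks_multiply, Matrix.fromBlocks_multiply, Matrix.fromBlocks_inj] at h
    have h4 := h.2.2.2
    simp only [Matrix.mul_zero, Matrix.mul_one, Matrix.mul_neg, zero_add, add_zero,
      Matrix.neg_mul] at h4
    first
      | exact neg_add_eq_zero.mp h4
      | exact (add_neg_eq_zero.mp h4).symm
  have hCD' : g.toBlocks₂₁.map Complex.ofReal * (g.toBlocks₂₂.map Complex.ofReal)ᵀ =
      g.toBlocks₂₂.map Complex.ofReal * (g.toBlocks₂₁.map Complex.ofReal)ᵀ := by
    have h := congrArg (fun M : Matrix n n ℝ => M.map Complex.ofRealHom) hCD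
    simp only [Matrix.map_mul] at h
    exact h
  unfold bigDelta
  by_cases hu : IsUnit (autoFactor g Z).det
  · have hM : g.toBlocks₂₁.map Complex.ofReal * (autoFactor g Z)ᵀ =
        autoFactor g Z * (g.toBlocks₂₁.map Complex.ofReal)ᵀ := by
      simp only [autoFactor, Matrix.transpose_add, Matrix.transpose_mul, hZ.eq, Matrix.mul_add,
        Matrix.add_mul, hCD', Matrix.mul_assoc]
    have hu' : IsUnit ((autoFactor g Z)ᵀ).det := by rwa [Matrix.det_transpose]
    rw [Matrix.IsSymm, Matrix.transpose_mul, Matrix.transpose_nonsing_inv]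
    calc (g.toBlocks₂₁.map Complex.ofReal)ᵀ * ((autoFactor g Z)ᵀ)⁻¹
        = (autoFactor g Z)⁻¹ * (autoFactor g Z * (g.toBlocks₂₁.map Complex.ofReal)ᵀ) *
            ((autoFactor g Z)ᵀ)⁻¹ := by rw [Matrix.nonsing_inv_mul_cancel_left _ _ hu]
      _ = (autoFactor g Z)⁻¹ * g.toBlocks₂₁.map Complex.ofReal := by
          rw [← hM, ← Matrix.mul_assoc, Matrix.mul_nonsing_inv_cancel_right _ _ hu']
  · rw [Matrix.nonsing_inv_apply_not_isUnit _ hu, Matrix.zero_mul]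
    exact Matrix.transpose_zero

theorem bigE_isSymm {Z : Matrix n n ℂ} (hZ : Z.IsSymm) : (bigE Z).IsSymm := by
  have h : (Z.map Complex.im)ᵀ = Z.map Complex.im := by
    rw [← Matrix.transpose_map, hZ.eq]
  rw [Matrix.IsSymm, bigE, Matrix.transpose_smul, ← Matrix.transpose_map,
    Matrix.transpose_nonsing_inv, h]

theorem bigDelta_sub_bigE_isSymm {g : Matrix (n ⊕ n) (n ⊕ n) ℝ}
    (hg : g ∈ Matrix.symplecticGroup n ℝ) {Z : Matrix n n ℂ} (hZ : Z.IsSymm) :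
    (bigDelta g Z - bigE Z).IsSymm :=
  (bigDelta_isSymm hg hZ).sub (bigE_isSymm hZ)

theorem blockDiag_isSymm {p q : Type*} {Z : Matrix p p ℂ} {W : Matrix q q ℂ}
    (hZ : Z.IsSymm) (hW : W.IsSymm) : (Matrix.fromBlocks Z 0 0 W).IsSymm :=
  Matrix.IsSymm.fromBlocks hZ (Matrix.transpose_zero) hW

end Siegel

/-! ### Substituting matrices and differential operators into polynomials -/

section Substitution

variable {ι n : Type*} [DecidableEq n]

/-- The value `A^{αβ} = e^{(α)} A ᵗe^{(β)}` of the indeterminate `X^{αβ}` at a symmetric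
matrix `A`, for row vectors `e^{(α)}`. -/
def linkValue [Fintype n] {A : Matrix n n ℂ} (hA : A.IsSymm) (e : ι → n → ℂ) : Sym2 ι → ℂ :=
  Sym2.lift ⟨fun α β => e α ⬝ᵥ (A *ᵥ e β), fun α β => by
    change e α ⬝ᵥ (A *ᵥ e β) = e β ⬝ᵥ (A *ᵥ e α)
    rw [Matrix.dotProduct_mulVec, ← Matrix.mulVec_transpose, hA.eq, dotProduct_comm]⟩

/-- The direction in the space of symmetric matrices that changes the coordinate
`z_{μν} = z_{νμ}` at unit speed and no other coordinate. -/
def coordDir (μ ν : n) : Matrix n n ℂ :=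
  Matrix.of fun i j => if s(i, j) = s(μ, ν) then 1 else 0

/-- The Wirtinger derivative `∂/∂z_{μν} = (∂/∂x_{μν} - i ∂/∂y_{μν}) / 2` of a function of the
symmetric matrix `Z = (z_{μν})`, `z_{μν} = x_{μν} + i y_{μν}`. -/
def wirtinger (μ ν : n) (f : Matrix n n ℂ → ℂ) (Z : Matrix n n ℂ) : ℂ :=
  (1 / 2) * (lineDeriv ℝ f Z (coordDir μ ν) -
    Complex.I * lineDeriv ℝ f Z (Complex.I • coordDir μ ν))

/-- The `(μ, ν)` entry `((1 + δ_{μν}) / 2) ∂/∂z_{μν}` of the matrix `∂`. -/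
def diffEntry (μ ν : n) (f : Matrix n n ℂ → ℂ) (Z : Matrix n n ℂ) : ℂ :=
  ((1 + if μ = ν then 1 else 0) / 2) * wirtinger μ ν f Z

theorem diffEntry_comm (μ ν : n) (f : Matrix n n ℂ → ℂ) (Z : Matrix n n ℂ) :
    diffEntry μ ν f Z = diffEntry ν μ f Z := by
  simp only [diffEntry, wirtinger, coordDir, Sym2.eq_swap (a := μ) (b := ν), eq_comm (a := μ)]

/-- The operator `∂^{αβ} = e^{(α)} ∂ ᵗe^{(β)} = ∑_{μ,ν} e_μ^{(α)} e_ν^{(β)} ∂_{μν}`. -/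
def diffLink [Fintype n] (e : ι → n → ℂ) : Sym2 ι → (Matrix n n ℂ → ℂ) → (Matrix n n ℂ → ℂ) :=
  Sym2.lift ⟨fun α β f Z => ∑ μ, ∑ ν, e α μ * e β ν * diffEntry μ ν f Z, fun α β => by
    funext f Z
    change ∑ μ, ∑ ν, e α μ * e β ν * diffEntry μ ν f Z =
      ∑ μ, ∑ ν, e β μ * e α ν * diffEntry μ ν f Z
    rw [Finset.sum_comm]
    refine Finset.sum_congr rfl fun μ _ => Finset.sum_congr rfl fun ν _ => ?_
    rw [diffEntry_comm, mul_comm (e α ν)]⟩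

/-- The operator obtained from a monomial in the `X^{αβ}` by replacing every `X^{αβ}` by
`∂^{αβ}` and the product by composition. The order of composition is immaterial, because partial
derivatives of smooth functions commute; an arbitrary order is used. -/
def diffMonomial [Fintype n] (e : ι → n → ℂ) (m : Sym2 ι →₀ ℕ) (f : Matrix n n ℂ → ℂ) :
    Matrix n n ℂ → ℂ :=
  (Finsupp.toMultiset m).toList.foldr (diffLink e) f

/-- `P(∂) f`. -/
def polyDiff [Fintype n] (e : ι → n → ℂ) (P : MvPolynomial (Sym2 ι) ℂ) (f : Matrix n n ℂ → ℂ)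
    (Z : Matrix n n ℂ) : ℂ :=
  ∑ m ∈ P.support, P.coeff m * diffMonomial e m f Z

/-- The row vectors `e^{(a^*)} = (x_{a1}, …, x_{ap}, 0, …, 0)` and
`e^{(b_*)} = (0, …, 0, y_{b1}, …, y_{bq})`. -/
def blockVec {l p q : ℕ} (x : Fin l → Fin p → ℂ) (y : Fin l → Fin q → ℂ) :
    Fin l ⊕ Fin l → Fin p ⊕ Fin q → ℂ :=
  Sum.elim (fun a => Sum.elim (x a) 0) (fun b => Sum.elim 0 (y b))

end Substitution

end

end SiegelPullback

/-!
# Pluri-harmonic differential operators and restriction to block diagonal points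

Wirtinger derivatives `∂_H` in a symmetric direction `H` satisfy the Riccati equations `∂_H Δ = -Δ H Δ` and
`∂_H E = -E H E`, and the weight `f = δ^{-k} |δ|^{-2s} ε^s` has the logarithmic derivative
`∂_H log f = -½ ((2k + 2s) tr (Δ H) + (-2s) tr (E H))`. Formally, `f` thus behaves like `det (Δ)^{(2k+2s)/2} det (E)^{(-2s)/2}`, the
normalization of a Gaussian measure in two groups of variables (the *colours* `true` and `false`) with inverse
covariances proportional to `Δ⁻¹` and `E⁻¹` and of the dimensions `2k + 2s` and `-2s`. Differentiating such an integral
produces moments, and so `f⁻¹ P(∂) f` is the mean of `P`, each `X^{αβ}` being replaced by the sum of the inner products of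
the Gaussian vectors `y_α`, `y_β` of the two colours, with covariances `-Δ^{αβ}/2` and `-E^{αβ}/2`.

Since the dimensions are complex numbers, the mean is defined algebraically: it is the constant term of a power of a heat
operator, written in terms of the inner products `X_c^{αβ}` of the vectors of colour `c`, where the dimension is a mere
parameter (`heat`, `expectation`). Heat operators commute with each other, and their double commutator with a multiplication
is again a heat operator; hence the moment recursion `expectation_succ_link`. The derivatives of `f` obey the same
recursion (`foldr_diffLink_eq`, `polyDiff_eq`).

Now subtract the covariance `-E/2` from both colours. At a block diagonal point `E` pairs no starred with a lower-starred index,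
so its heat operator, which acts on `P` in the total dimension `(2k + 2s) + (-2s) = 2k`, is a combination of the Laplacians that
annihilate `P` (`heat_colorSum_eq_zero`). Therefore the mean does not change (`expectation_add_of_heat_eq_zero`), and it is
the mean for the covariances `-(Δ - E)/2` and `0`, that is, a polynomial in the `(Δ - E)^{αβ}` and in `s`
(`pullbackPolynomial`, `eval_pullbackPolynomial`). It is homogeneous because heat operators preserve multidegrees
(`IsJointlyHomogeneous.expectation`).
-/

namespace SiegelPullback

noncomputable section

set_option linter.unusedSectionVars false

/-! ### Contractions, rotations and heat operators -/

section Operators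

variable {ι R A : Type*} [DecidableEq ι] [CommRing R] [Ring A] [Algebra R A]

/-- The commutation relations between the multiplications by `X^{αβ} = X^{βα}` and the derivatives `p^{αβ}`, where
`p^{αβ} = ∂/∂X^{αβ}` for `α ≠ β` and `p^{αα} = 2 ∂/∂X^{αα}`. The factor 2 makes the relations uniform in the
indices. -/
structure IsPolarizedPair (X p : ι → ι → A) : Prop where
  X_symm : ∀ α β, X α β = X β α
  p_symm : ∀ α β, p α β = p β α
  X_comm : ∀ α β γ δ, ⁅X α β, X γ δ⁆ = 0
  p_comm : ∀ α β γ δ, ⁅p α β, p γ δ⁆ = 0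
  p_X : ∀ α β γ δ, ⁅p α β, X γ δ⁆ =
    (if α = γ then (if β = δ then 1 else 0) else 0) + (if α = δ then (if β = γ then 1 else 0) else 0)

theorem bracket_add (a b c : A) : ⁅a, b + c⁆ = ⁅a, b⁆ + ⁅a, c⁆ := by
  simp only [Ring.lie_def]; noncomm_ring

theorem add_bracket (a b c : A) : ⁅a + b, c⁆ = ⁅a, c⁆ + ⁅b, c⁆ := by
  simp only [Ring.lie_def]; noncomm_ring

theorem bracket_sum {κ : Type*} (t : Finset κ) (a : A) (f : κ → A) :
    ⁅a, ∑ i ∈ t, f i⁆ = ∑ i ∈ t, ⁅a, f i⁆ := by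
  simp only [Ring.lie_def, Finset.mul_sum, Finset.sum_mul, Finset.sum_sub_distrib]

theorem sum_bracket {κ : Type*} (t : Finset κ) (a : A) (f : κ → A) :
    ⁅∑ i ∈ t, f i, a⁆ = ∑ i ∈ t, ⁅f i, a⁆ := by
  simp only [Ring.lie_def, Finset.mul_sum, Finset.sum_mul, Finset.sum_sub_distrib]

theorem bracket_skew (a b : A) : -⁅b, a⁆ = ⁅a, b⁆ := by
  simp only [Ring.lie_def, neg_sub]

theorem bracket_mul (a b c : A) : ⁅a, b * c⁆ = ⁅a, b⁆ * c + b * ⁅a, c⁆ := by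
  simp only [Ring.lie_def]; noncomm_ring

theorem bracket_smul (d : R) (a b : A) : ⁅a, d • b⁆ = d • ⁅a, b⁆ := by
  rw [Ring.lie_def, Ring.lie_def, mul_smul_comm, smul_mul_assoc, smul_sub]

theorem smul_bracket (d : R) (a b : A) : ⁅d • a, b⁆ = d • ⁅a, b⁆ := by
  rw [Ring.lie_def, Ring.lie_def, mul_smul_comm, smul_mul_assoc, smul_sub]

theorem mul_bracket (a b c : A) : ⁅a * b, c⁆ = a * ⁅b, c⁆ + ⁅a, c⁆ * b := by
  simp only [Ring.lie_def]; noncomm_ring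

variable [Fintype ι]

/-- The operator that is `∑_κ y_{βκ} ∂/∂y_{εκ}` on functions of `X^{αβ} = ∑_κ y_{ακ} y_{βκ}`. -/
def rotation (X p : ι → ι → A) (β ε : ι) : A := ∑ ν, X β ν * p ε ν

/-- The operator that is `∑_κ ∂²/∂y_{γκ}∂y_{δκ}` on functions of `X^{αβ} = ∑_κ y_{ακ} y_{βκ}`, with `d` in place of
the number of values of `κ`. On multilinear polynomials it is `laplacian d γ δ` for `γ ≠ δ`. -/
def contraction (d : R) (X p : ι → ι → A) (γ δ : ι) : A :=
  d • p γ δ + ∑ μ, ∑ ν, X μ ν * (p γ μ * p δ ν)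

namespace IsPolarizedPair

variable {X p : ι → ι → A} (h : IsPolarizedPair X p) (d : R)
include h

theorem commute_p (α β γ δ : ι) : p α β * p γ δ = p γ δ * p α β := by
  have := h.p_comm α β γ δ
  rwa [Ring.lie_def, sub_eq_zero] at this

theorem contraction_symm (γ δ : ι) : contraction d X p γ δ = contraction d X p δ γ := by
  unfold contraction
  rw [h.p_symm γ δ, Finset.sum_comm]
  congr 1
  refine Finset.sum_congr rfl fun μ _ => Finset.sum_congr rfl fun ν _ => ?_
  rw [h.X_symm, h.commute_p]

theorem contraction_eq (γ δ : ι) :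
    contraction d X p γ δ = d • p γ δ + ∑ ν, rotation X p ν γ * p δ ν := by
  unfold contraction rotation
  congr 1
  rw [Finset.sum_comm]
  refine Finset.sum_congr rfl fun ν _ => ?_
  rw [Finset.sum_mul]
  refine Finset.sum_congr rfl fun μ _ => ?_
  rw [h.X_symm, mul_assoc]

theorem X_p (α β γ δ : ι) : ⁅X γ δ, p α β⁆ =
    -((if α = γ then (if β = δ then 1 else 0) else 0) + (if α = δ then (if β = γ then 1 else 0) else 0)) := by
  rw [← h.p_X, bracket_skew]

theorem rotation_X (β ε μ ν : ι) : ⁅rotation X p β ε, X μ ν⁆ =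
    (if ε = μ then X β ν else 0) + (if ε = ν then X β μ else 0) := by
  simp only [rotation, sum_bracket, mul_bracket, h.p_X, h.X_comm, zero_mul, add_zero, mul_add, mul_ite,
    mul_one, mul_zero, Finset.sum_add_distrib]
  congr 1 <;> split_ifs <;> simp

theorem rotation_p (β ε γ δ : ι) : ⁅rotation X p β ε, p γ δ⁆ =
    -((if γ = β then p ε δ else 0) + (if δ = β then p ε γ else 0)) := by
  simp only [rotation, sum_bracket, mul_bracket, h.X_p, h.p_comm, mul_zero, zero_add, neg_mul, add_mul, ite_mul,
    one_mul, zero_mul, Finset.sum_add_distrib, Finset.sum_neg_distrib]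
  rw [neg_inj]
  congr 1
  · split_ifs <;> simp
  · simp only [← ite_and, and_comm (a := γ = _)]
    simp only [ite_and]
    split_ifs <;> simp

theorem contraction_p (γ δ ε ζ : ι) :
    ⁅contraction d X p γ δ, p ε ζ⁆ = -(p γ ε * p δ ζ + p γ ζ * p δ ε) := by
  simp only [contraction, add_bracket, smul_bracket, sum_bracket, mul_bracket, h.X_p, h.p_comm, smul_zero, mul_zero,
    zero_mul, zero_add, add_zero, neg_mul, add_mul, ite_mul, one_mul, Finset.sum_add_distrib,
    Finset.sum_neg_distrib]
  rw [neg_inj]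
  congr 1
  · rw [Finset.sum_eq_single ε (by intro b _ hb; simp [hb.symm]) (by simp)]
    simp
  · rw [Finset.sum_eq_single ζ (by intro b _ hb; simp [hb.symm]) (by simp)]
    simp

theorem contraction_X (γ δ α β : ι) :
    ⁅contraction d X p γ δ, X α β⁆ =
      (if γ = α then (if δ = β then algebraMap R A d else 0) + rotation X p β δ else 0) +
      (if γ = β then (if δ = α then algebraMap R A d else 0) + rotation X p α δ else 0) +
      (if δ = α then rotation X p β γ else 0) + (if δ = β then rotation X p α γ else 0) := by
  simp only [h.contraction_eq, add_bracket, smul_bracket, sum_bracket, mul_bracket, h.rotation_X, h.p_X,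
    mul_add, add_mul, ite_mul, mul_ite, zero_mul, mul_zero, mul_one, Finset.sum_add_distrib, smul_add,
    smul_ite, smul_zero, Algebra.algebraMap_eq_smul_one]
  have h1 : ∀ b, ∑ ν, X ν b * p δ ν = rotation X p b δ := fun b => by
    simp only [rotation, h.X_symm b]
  have h2 : ∀ (q : Prop) [Decidable q] (F : ι → A), ∑ x, (if q then F x else 0) =
      if q then ∑ x, F x else 0 := fun q _ F => by split_ifs <;> simp
  simp only [h2, h1, Finset.sum_ite_eq', Finset.mem_univ, if_true]
  split_ifs <;> abel

theorem contraction_rotation (γ δ β ε : ι) :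
    ⁅contraction d X p γ δ, rotation X p β ε⁆ =
      (if γ = β then contraction d X p δ ε else 0) + (if δ = β then contraction d X p γ ε else 0) := by
  have h2 : ∀ (q : Prop) [Decidable q] (F : ι → A), ∑ x, (if q then F x else 0) =
      if q then ∑ x, F x else 0 := fun q _ F => by split_ifs <;> simp
  rw [← bracket_skew, h.contraction_symm d δ ε]
  simp only [contraction, bracket_add, bracket_smul, bracket_sum, bracket_mul, h.rotation_X, h.rotation_p,
    add_mul, mul_add, mul_neg, neg_mul, ite_mul, mul_ite, zero_mul, mul_zero, Finset.sum_add_distrib,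
    Finset.sum_neg_distrib, h2, Finset.sum_ite_eq, Finset.sum_ite_eq', Finset.mem_univ, if_true,
    smul_neg, smul_add, smul_ite, smul_zero, h.p_symm δ ε, h.p_symm γ ε, h.X_symm _ β]
  split_ifs <;> abel

/-- Stated for an arbitrary ring element `d`, so that it cannot be read off from the second-order operators in the `y`. -/
theorem contraction_comm (γ δ ε ζ : ι) :
    ⁅contraction d X p γ δ, contraction d X p ε ζ⁆ = 0 := by
  conv_lhs => rw [h.contraction_eq d ε ζ]
  simp only [bracket_add, bracket_smul, bracket_sum, bracket_mul, h.contraction_rotation, h.contraction_p, add_mul,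
    ite_mul, zero_mul, Finset.sum_add_distrib, Finset.sum_ite_eq, Finset.mem_univ, if_true]
  rw [h.contraction_symm d δ ε, h.contraction_symm d γ ε, h.contraction_eq d ε δ, h.contraction_eq d ε γ]
  simp only [mul_neg, mul_add, Finset.sum_add_distrib, Finset.sum_neg_distrib, add_mul, Finset.sum_mul,
    smul_neg, smul_add, smul_mul_assoc, mul_assoc]
  simp only [h.p_symm ζ γ, h.p_symm ζ δ, h.p_symm ε γ, h.p_symm ε δ]
  simp only [h.commute_p δ _ γ ζ]
  abel

end IsPolarizedPair

variable {K : Type*} [DecidableEq K]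

/-- Commuting polarized pairs, one for each element of `K` (the colours). -/
structure IsPolarizedFamily (X p : K → ι → ι → A) : Prop where
  pair : ∀ c, IsPolarizedPair (X c) (p c)
  X_comm : ∀ c c' α β γ δ, ⁅X c α β, X c' γ δ⁆ = 0
  p_comm : ∀ c c' α β γ δ, ⁅p c α β, p c' γ δ⁆ = 0
  p_X : ∀ c c' α β γ δ, c ≠ c' → ⁅p c α β, X c' γ δ⁆ = 0

/-- The operator `∑_c ∑_{γ,δ} D_c^{γδ} ∑_κ ∂²/∂y_{γκ}∂y_{δκ}`, where the vectors `y` of colour `c` have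
dimension `d c`. -/
def heatOperator [Fintype K] (d : K → R) (X p : K → ι → ι → A) (D : K → Sym2 ι → R) : A :=
  ∑ c, ∑ γ, ∑ δ, D c s(γ, δ) • contraction (d c) (X c) (p c) γ δ

/-- The symmetric function `(γ, δ) ↦ D^{αγ} D^{βδ} + D^{αδ} D^{βγ}`. -/
def wickProduct (D : K → Sym2 ι → R) (α β : ι) (c : K) : Sym2 ι → R :=
  Sym2.lift ⟨fun γ δ => D c s(α, γ) * D c s(β, δ) + D c s(α, δ) * D c s(β, γ), fun _ _ => add_comm _ _⟩

namespace IsPolarizedFamily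

variable {X p : K → ι → ι → A} (h : IsPolarizedFamily X p) (d : K → R)
include h

theorem contraction_lie_p {c c' : K} (hc : c ≠ c') (γ δ α β : ι) :
    ⁅contraction (d c) (X c) (p c) γ δ, p c' α β⁆ = 0 := by
  have h1 : ∀ μ ν, ⁅X c μ ν, p c' α β⁆ = 0 := fun μ ν => by
    rw [← bracket_skew, h.p_X _ _ _ _ _ _ (Ne.symm hc), neg_zero]
  simp only [contraction, add_bracket, smul_bracket, sum_bracket, mul_bracket, h.p_comm, h1]
  simp

theorem contraction_lie_X {c c' : K} (hc : c ≠ c') (γ δ α β : ι) :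
    ⁅contraction (d c) (X c) (p c) γ δ, X c' α β⁆ = 0 := by
  simp only [contraction, add_bracket, smul_bracket, sum_bracket, mul_bracket, h.X_comm,
    h.p_X _ _ _ _ _ _ hc]
  simp

theorem contraction_comm (c c' : K) (γ δ α β : ι) :
    ⁅contraction (d c) (X c) (p c) γ δ, contraction (d c') (X c') (p c') α β⁆ = 0 := by
  by_cases hc : c = c'
  · subst hc
    exact (h.pair c).contraction_comm (d c) γ δ α β
  · conv_lhs => enter [2]; rw [contraction]
    simp only [bracket_add, bracket_smul, bracket_sum, bracket_mul, h.contraction_lie_X d hc,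
      h.contraction_lie_p d hc]
    simp

theorem contraction_rotation (c c' : K) (γ δ β ε : ι) :
    ⁅contraction (d c) (X c) (p c) γ δ, rotation (X c') (p c') β ε⁆ = if c = c' then
      (if γ = β then contraction (d c) (X c) (p c) δ ε else 0) +
        (if δ = β then contraction (d c) (X c) (p c) γ ε else 0) else 0 := by
  by_cases hc : c = c'
  · subst hc
    rw [if_pos rfl]
    exact (h.pair c).contraction_rotation (d c) γ δ β ε
  · rw [if_neg hc, rotation]
    simp only [bracket_sum, bracket_mul, h.contraction_lie_X d hc, h.contraction_lie_p d hc]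
    simp

variable [Fintype K] (D : K → Sym2 ι → R)

theorem heatOperator_comm (D' : K → Sym2 ι → R) :
    ⁅heatOperator d X p D, heatOperator d X p D'⁆ = 0 := by
  simp only [heatOperator, bracket_sum, sum_bracket, bracket_smul, smul_bracket, h.contraction_comm]
  simp

theorem heatOperator_rotation (c : K) (β ε : ι) :
    ⁅heatOperator d X p D, rotation (X c) (p c) β ε⁆ =
      (2 : R) • ∑ γ, D c s(β, γ) • contraction (d c) (X c) (p c) γ ε := by
  simp only [heatOperator, sum_bracket, smul_bracket, h.contraction_rotation]
  rw [Finset.sum_eq_single c (by intro b _ hb; simp [hb]) (by simp)]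
  simp only [if_true, smul_add, smul_ite, smul_zero, Finset.sum_add_distrib, two_smul]
  congr 1
  · rw [Finset.sum_eq_single β (by intro b _ hb; simp [hb]) (by simp)]
    simp
  · refine Finset.sum_congr rfl fun γ _ => ?_
    rw [Finset.sum_eq_single β (by intro b _ hb; simp [hb]) (by simp), if_pos rfl, Sym2.eq_swap]

theorem heatOperator_X (c : K) (α β : ι) :
    ⁅heatOperator d X p D, X c α β⁆ = (2 : R) • (algebraMap R A (d c * D c s(α, β)) +
      ∑ δ, (D c s(α, δ) • rotation (X c) (p c) β δ + D c s(β, δ) • rotation (X c) (p c) α δ)) := by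
  simp only [heatOperator, sum_bracket, smul_bracket]
  rw [Finset.sum_eq_single c (by intro b _ hb; simp [h.contraction_lie_X d hb]) (by simp)]
  simp only [(h.pair c).contraction_X]
  simp only [smul_add, smul_ite, smul_zero, Finset.sum_add_distrib]
  have h2 : ∀ (q : Prop) [Decidable q] (F : ι → A), ∑ x, (if q then F x else 0) =
      if q then ∑ x, F x else 0 := fun q _ F => by split_ifs <;> simp
  simp only [h2, Finset.sum_ite_eq', Finset.mem_univ, if_true, Finset.sum_add_distrib]
  have e : ∀ a b, ∑ x, D c s(x, a) • rotation (X c) (p c) b x =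
      ∑ x, D c s(a, x) • rotation (X c) (p c) b x := fun a b =>
    Finset.sum_congr rfl fun x _ => by rw [Sym2.eq_swap]
  rw [e, e, Sym2.eq_swap (a := β) (b := α)]
  simp only [two_smul R]
  have e3 : D c s(α, β) • algebraMap R A (d c) = algebraMap R A (d c * D c s(α, β)) := by
    rw [Algebra.smul_def, ← map_mul, mul_comm]
  rw [e3]
  abel

/-- The double commutator with `∑_c X_c^{αβ}` is again a heat operator; this is the source of the recursion for the
moments. -/
theorem heatOperator_heatOperator_X (α β : ι) :
    ⁅heatOperator d X p D, ⁅heatOperator d X p D, ∑ c, X c α β⁆⁆ =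
      (4 : R) • heatOperator d X p (wickProduct D α β) := by
  have h0 : ∀ (a : R) (T : A), ⁅T, algebraMap R A a⁆ = 0 := fun a T => by
    rw [Ring.lie_def, sub_eq_zero]; exact (Algebra.commutes a T).symm
  simp only [bracket_sum, h.heatOperator_X, bracket_smul, bracket_add, h0, h.heatOperator_rotation, zero_add]
  rw [heatOperator, Finset.smul_sum]
  refine Finset.sum_congr rfl fun c _ => ?_
  simp only [wickProduct, Sym2.lift_mk, add_smul, Finset.sum_add_distrib, Finset.smul_sum, smul_smul, smul_add]
  congr 1 <;>
  · refine Finset.sum_congr rfl fun γ _ => Finset.sum_congr rfl fun δ _ => ?_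
    rw [(h.pair c).contraction_symm]
    congr 1; ring

end IsPolarizedFamily
end Operators

/-! ### Moments of coloured polynomials -/

section Wick

variable {K ι B : Type*} [DecidableEq K] [DecidableEq ι] [CommRing B]

/-- Multiplication by the variable `X_c^{αβ}`. -/
def linkMul (B : Type*) [CommRing B] (c : K) (α β : ι) : Module.End B (MvPolynomial (K × Sym2 ι) B) :=
  LinearMap.mulLeft B (MvPolynomial.X (c, s(α, β)))

/-- The derivative by `X_c^{αβ}`, doubled on the diagonal as `IsPolarizedPair` demands. -/
def linkDeriv (B : Type*) [CommRing B] (c : K) (α β : ι) : Module.End B (MvPolynomial (K × Sym2 ι) B) :=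
  (if α = β then 2 else 1 : B) • (MvPolynomial.pderiv (c, s(α, β))).toLinearMap

theorem linkMul_apply (c : K) (α β : ι) (m : MvPolynomial (K × Sym2 ι) B) :
    linkMul B c α β m = MvPolynomial.X (c, s(α, β)) * m := rfl

theorem linkDeriv_apply (c : K) (α β : ι) (m : MvPolynomial (K × Sym2 ι) B) :
    linkDeriv B c α β m = (if α = β then 2 else 1 : B) • MvPolynomial.pderiv (c, s(α, β)) m := rfl

theorem pderiv_comm {σ : Type*} (i j : σ) (m : MvPolynomial σ B) :
    MvPolynomial.pderiv i (MvPolynomial.pderiv j m) = MvPolynomial.pderiv j (MvPolynomial.pderiv i m) := by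
  classical
  have h : ⁅(MvPolynomial.pderiv i : Derivation B (MvPolynomial σ B) (MvPolynomial σ B)), MvPolynomial.pderiv (R := B) j⁆ = 0 := by
    refine MvPolynomial.derivation_ext fun k => ?_
    rw [Derivation.commutator_apply, MvPolynomial.pderiv_X, MvPolynomial.pderiv_X]
    simp only [Pi.single_apply, apply_ite (MvPolynomial.pderiv (R := B) i), apply_ite (MvPolynomial.pderiv (R := B) j), map_zero, MvPolynomial.pderiv_one]
    simp
  have h2 := congrArg (fun D => D m) h
  simpa [Derivation.commutator_apply, sub_eq_zero] using h2

theorem lie_linkMul_linkMul (c c' : K) (α β γ δ : ι) : ⁅linkMul B c α β, linkMul B c' γ δ⁆ = 0 := by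
  rw [Ring.lie_def, sub_eq_zero]
  refine LinearMap.ext fun m => ?_
  simp only [Module.End.mul_apply, linkMul_apply]; ring

theorem lie_linkDeriv_linkDeriv (c c' : K) (α β γ δ : ι) :
    ⁅linkDeriv B c α β, linkDeriv B c' γ δ⁆ = 0 := by
  rw [Ring.lie_def, sub_eq_zero]
  refine LinearMap.ext fun m => ?_
  simp only [Module.End.mul_apply, linkDeriv_apply, map_smul, pderiv_comm (c, s(α, β))]
  rw [smul_comm]

theorem lie_linkDeriv_linkMul (c c' : K) (α β γ δ : ι) :
    ⁅linkDeriv B c α β, linkMul B c' γ δ⁆ = if c = c' then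
      (if α = γ then (if β = δ then 1 else 0) else 0) + (if α = δ then (if β = γ then 1 else 0) else 0)
      else 0 := by
  refine LinearMap.ext fun m => ?_
  have h1 : ⁅linkDeriv B c α β, linkMul B c' γ δ⁆ m = (if α = β then 2 else 1 : B) •
      ((MvPolynomial.pderiv (c, s(α, β)) (MvPolynomial.X (c', s(γ, δ)) : MvPolynomial (K × Sym2 ι) B)) * m) := by
    rw [Ring.lie_def]
    simp only [LinearMap.sub_apply, Module.End.mul_apply, linkDeriv_apply, linkMul_apply, Derivation.leibniz,
      smul_add, smul_eq_mul, mul_smul_comm]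
    ring_nf
  rw [h1, MvPolynomial.pderiv_X, Pi.single_apply]
  by_cases hc : c = c'
  · subst hc
    simp only [Prod.mk.injEq, true_and, Sym2.eq_iff, if_true]
    by_cases h1 : γ = α
    · subst h1
      by_cases h2 : δ = β
      · subst h2
        by_cases h3 : γ = δ
        · subst h3; simp [two_smul, one_add_one_eq_two]
        · simp [h3]
      · have h2' : ¬ β = δ := fun e => h2 e.symm
        by_cases h3 : γ = β
        · subst h3; simp [h2, h2']
        · simp [h2, h2', h3, eq_comm (a := β)]
    · have h1' : ¬ α = γ := fun e => h1 e.symm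
      by_cases h2 : α = δ
      · subst h2
        by_cases h3 : β = γ
        · subst h3; simp [h1']
        · simp [h1', h3, eq_comm (a := γ)]
      · have h2' : ¬ δ = α := fun e => h2 e.symm
        simp [h1, h1', h2, h2']
  · simp [hc, Ne.symm hc]

theorem isPolarizedPair_link (c : K) : IsPolarizedPair (linkMul (ι := ι) B c) (linkDeriv B c) where
  X_symm α β := by simp only [linkMul, Sym2.eq_swap (a := α)]
  p_symm α β := by simp only [linkDeriv, Sym2.eq_swap (a := α), eq_comm (a := α)]
  X_comm := lie_linkMul_linkMul c c
  p_comm := lie_linkDeriv_linkDeriv c c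
  p_X α β γ δ := by rw [lie_linkDeriv_linkMul, if_pos rfl]

variable [Fintype ι]

theorem isPolarizedFamily_link : IsPolarizedFamily (fun c : K => linkMul (ι := ι) B c) (linkDeriv B) where
  pair := isPolarizedPair_link
  X_comm := lie_linkMul_linkMul
  p_comm := lie_linkDeriv_linkDeriv
  p_X c c' α β γ δ hc := by rw [lie_linkDeriv_linkMul, if_neg hc]

variable [Fintype K]

/-- The heat operator on polynomials in the variables `X_c^{αβ}`. -/
def heat (d : K → B) (D : K → Sym2 ι → B) : Module.End B (MvPolynomial (K × Sym2 ι) B) :=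
  heatOperator d (linkMul B) (linkDeriv B) D

theorem heat_comm (d : K → B) (D D' : K → Sym2 ι → B) : ⁅heat d D, heat d D'⁆ = 0 :=
  isPolarizedFamily_link.heatOperator_comm d D D'

theorem heat_bracket_linkMul (d : K → B) (D : K → Sym2 ι → B) (c : K) (α β : ι) :
    ⁅heat d D, linkMul B c α β⁆ = (2 : B) • (algebraMap B _ (d c * D c s(α, β)) +
      ∑ δ, (D c s(α, δ) • rotation (linkMul B c) (linkDeriv B c) β δ +
        D c s(β, δ) • rotation (linkMul B c) (linkDeriv B c) α δ)) :=
  isPolarizedFamily_link.heatOperator_X d D c α β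

theorem heat_bracket_bracket_linkMul (d : K → B) (D : K → Sym2 ι → B) (α β : ι) :
    ⁅heat d D, ⁅heat d D, ∑ c, linkMul B c α β⁆⁆ = (4 : B) • heat d (wickProduct D α β) :=
  isPolarizedFamily_link.heatOperator_heatOperator_X d D α β

/-- Binomial expansion of `H ^ (n + 1) * M` when the triple commutator of `H` with `M` vanishes. For `n = 0` the last
term has the coefficient `choose 1 2 = 0`. -/
theorem pow_mul_of_lie {A : Type*} [Ring A] {H M a g : A} (h1 : ⁅H, M⁆ = a) (h2 : ⁅H, a⁆ = g)
    (h3 : ⁅H, g⁆ = 0) (n : ℕ) :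
    H ^ (n + 1) * M = M * H ^ (n + 1) + (n + 1) • (a * H ^ n) + (n + 1).choose 2 • (g * H ^ (n - 1)) := by
  have e1 : H * M = M * H + a := by rw [← h1, Ring.lie_def]; abel
  have e2 : H * a = a * H + g := by rw [← h2, Ring.lie_def]; abel
  have e3 : H * g = g * H := by rwa [Ring.lie_def, sub_eq_zero] at h3
  induction n with
  | zero => simp [e1]
  | succ n ih =>
    rw [pow_succ', mul_assoc, ih]
    rw [mul_add, mul_add, mul_smul_comm, mul_smul_comm, ← mul_assoc, ← mul_assoc, ← mul_assoc, e1, e2, e3, add_mul,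
      add_mul, mul_assoc, mul_assoc, mul_assoc, ← pow_succ', ← pow_succ']
    have e4 : (n + 1).choose 2 • (g * (H * H ^ (n - 1))) = (n + 1).choose 2 • (g * H ^ n) := by
      rcases n with _ | n
      · simp
      · rw [← pow_succ']; rfl
    rw [e4, Nat.add_sub_cancel, Nat.choose_succ_succ' (n + 1) 1, Nat.choose_one_right]
    simp only [smul_add, add_smul, one_smul]
    abel

/-- The `n`-th heat iterate of `m`, evaluated at zero. For `m` of degree `n` and `d c = N_c` a positive integer,
`expectation d D n m / (2 ^ n * n!)` is the mean of `m` under the substitution of `∑_κ y_{ακ} y_{βκ}`, `κ ≤ N_c`, for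
`X_c^{αβ}`, where the vectors `y` of colour `c` are Gaussian with covariance `D c`. The definition makes sense
for all `d`, which is what allows complex dimensions. -/
def expectation (d : K → B) (D : K → Sym2 ι → B) (n : ℕ) (m : MvPolynomial (K × Sym2 ι) B) : B :=
  MvPolynomial.constantCoeff ((heat d D ^ n) m)

/-- The moment recursion (Wick's formula for the factor `∑_c X_c^{αβ}`): the two new vectors are contracted either with
each other, or with two vectors in `m`. The derivative of the weight function obeys the same recursion. -/
theorem expectation_succ_link (d : K → B) (D : K → Sym2 ι → B) (n : ℕ) (α β : ι) (m : MvPolynomial (K × Sym2 ι) B) :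
    expectation d D (n + 1) ((∑ c, MvPolynomial.X (c, s(α, β))) * m) =
      2 * (n + 1) * ((∑ c, d c * D c s(α, β)) * expectation d D n m +
        n * MvPolynomial.constantCoeff (heat d (wickProduct D α β) ((heat d D ^ (n - 1)) m))) := by
  have h := pow_mul_of_lie (H := heat d D) rfl (heat_bracket_bracket_linkMul d D α β)
    ((bracket_smul (4 : B) _ _).trans (by rw [heat_comm, smul_zero])) n
  have hm := congrArg (fun T => MvPolynomial.constantCoeff (T m)) h
  have e1 : (∑ c, linkMul B c α β) m = (∑ c, MvPolynomial.X (c, s(α, β))) * m := by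
    simp [LinearMap.sum_apply, linkMul_apply, Finset.sum_mul]
  have e2 : ∀ q : MvPolynomial (K × Sym2 ι) B, MvPolynomial.constantCoeff ((∑ c, linkMul B c α β) q) = 0 := fun q => by
    simp [LinearMap.sum_apply, linkMul_apply]
  have e3 : ∀ (c : K) (μ ν : ι) (q : MvPolynomial (K × Sym2 ι) B),
      MvPolynomial.constantCoeff (rotation (linkMul B c) (linkDeriv B c) μ ν q) = 0 := fun c μ ν q => by
    simp [rotation, LinearMap.sum_apply, linkMul_apply]
  have e4 : ∀ q : MvPolynomial (K × Sym2 ι) B, MvPolynomial.constantCoeff (⁅heat d D, ∑ c, linkMul B c α β⁆ q) =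
      2 * (∑ c, d c * D c s(α, β)) * MvPolynomial.constantCoeff q := fun q => by
    simp only [bracket_sum, heat_bracket_linkMul, LinearMap.sum_apply, map_sum, LinearMap.smul_apply, LinearMap.add_apply, Module.algebraMap_end_apply]
    simp only [
      MvPolynomial.smul_eq_C_mul, map_mul, map_add, map_sum, e3, MvPolynomial.constantCoeff_C, mul_zero, add_zero,
      Finset.sum_const_zero, Finset.mul_sum, Finset.sum_mul]
    refine Finset.sum_congr rfl fun c _ => by ring
  have e5 : ((n + 1).choose 2 : B) * 4 = 2 * (n + 1) * n := by
    have := Nat.triangle_succ n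
    have h6 : (n + 1).choose 2 * 2 = (n + 1) * n := by
      rw [Nat.choose_two_right, Nat.add_sub_cancel, Nat.div_mul_cancel (by rw [mul_comm]; exact (Nat.even_mul_succ_self n).two_dvd)]
    have h7 := congrArg (fun k : ℕ => (k : B)) h6
    push_cast at h7
    linear_combination 2 * h7
  simp only [Module.End.mul_apply, LinearMap.add_apply, LinearMap.smul_apply] at hm
  simp only [map_add, e1, e2, e4, zero_add, nsmul_eq_mul, map_mul, map_natCast, MvPolynomial.smul_eq_C_mul, MvPolynomial.constantCoeff_C] at hm
  unfold expectation
  rw [hm]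
  push_cast
  linear_combination (MvPolynomial.constantCoeff (heat d (wickProduct D α β) ((heat d D ^ (n - 1)) m))) * e5

end Wick

/-! ### Forgetting colours, and change of scalars -/

section Colors

variable {K ι : Type*} [DecidableEq K] [DecidableEq ι] [Fintype K] [Fintype ι]
variable {B B' : Type*} [CommRing B] [CommRing B']

/-- The substitution `X^{αβ} ↦ ∑_c X_c^{αβ}`: vectors that are the concatenation of one vector for each colour have as
inner products the sums of the inner products of the parts. -/
def colorSum (K : Type*) [Fintype K] : MvPolynomial (Sym2 ι) B →ₐ[B] MvPolynomial (K × Sym2 ι) B :=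
  MvPolynomial.aeval fun u => ∑ c, MvPolynomial.X (c, u)

theorem colorSum_X (u : Sym2 ι) :
    colorSum K (MvPolynomial.X u : MvPolynomial (Sym2 ι) B) = ∑ c, MvPolynomial.X (c, u) :=
  MvPolynomial.aeval_X _ _

theorem pderiv_colorSum (c : K) (u : Sym2 ι) (P : MvPolynomial (Sym2 ι) B) :
    MvPolynomial.pderiv (c, u) (colorSum K P) = colorSum K (MvPolynomial.pderiv u P) := by
  induction P using MvPolynomial.induction_on with
  | C a => simp [colorSum]
  | add p q hp hq => simp only [map_add, hp, hq]
  | mul_X p v hp =>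
    have h : MvPolynomial.pderiv (c, u) (∑ c', MvPolynomial.X (c', v) : MvPolynomial (K × Sym2 ι) B) =
        colorSum K (MvPolynomial.pderiv u (MvPolynomial.X v : MvPolynomial (Sym2 ι) B)) := by
      simp only [map_sum, MvPolynomial.pderiv_X, Pi.single_apply, Prod.mk.injEq]
      rw [Finset.sum_eq_single c (by intro b _ hb; simp [hb]) (by simp)]
      by_cases huv : v = u <;> simp [huv]
    rw [map_mul, colorSum_X, Derivation.leibniz, Derivation.leibniz, h, hp]
    simp [colorSum_X]

/-- The contraction in all colours together, of dimensions `d c`, is the contraction of the uncoloured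
variables in dimension `∑ c, d c`. -/
theorem contraction_colorSum (d : K → B) (γ δ : ι) (P : MvPolynomial (Sym2 ι) B) :
    ∑ c, contraction (d c) (linkMul B c) (linkDeriv B c) γ δ (colorSum K P) =
      colorSum K ((∑ c, d c) • ((if γ = δ then 2 else 1 : B) • MvPolynomial.pderiv s(γ, δ) P) +
        ∑ μ, ∑ ν, MvPolynomial.X s(μ, ν) * ((if γ = μ then 2 else 1 : B) • MvPolynomial.pderiv s(γ, μ)
          ((if δ = ν then 2 else 1 : B) • MvPolynomial.pderiv s(δ, ν) P))) := by
  have h : ∀ (c : K) (α β : ι) (P : MvPolynomial (Sym2 ι) B), linkDeriv B c α β (colorSum K P) =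
      colorSum K ((if α = β then 2 else 1 : B) • MvPolynomial.pderiv s(α, β) P) := fun c α β P => by
    rw [linkDeriv_apply, pderiv_colorSum, map_smul]
  simp only [contraction, LinearMap.add_apply, LinearMap.smul_apply, LinearMap.sum_apply,
    Module.End.mul_apply, linkMul_apply, h]
  rw [map_add, map_smul, Finset.sum_smul, Finset.sum_add_distrib]
  simp only [map_sum, map_mul, colorSum_X, Finset.sum_mul]
  congr 1
  · simp only [map_smul]
  rw [Finset.sum_comm]
  refine Finset.sum_congr rfl fun μ _ => ?_
  rw [Finset.sum_comm]

theorem heat_apply (d : K → B) (D : K → Sym2 ι → B) (m : MvPolynomial (K × Sym2 ι) B) :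
    heat d D m = ∑ c, ∑ γ, ∑ δ, D c s(γ, δ) • contraction (d c) (linkMul B c) (linkDeriv B c) γ δ m := by
  simp only [heat, heatOperator, LinearMap.sum_apply, LinearMap.smul_apply]

theorem heat_add (d : K → B) (D D' : K → Sym2 ι → B) :
    heat d (D + D') = heat d D + heat d D' := by
  refine LinearMap.ext fun m => ?_
  simp only [heat_apply, LinearMap.add_apply, Pi.add_apply, add_smul, Finset.sum_add_distrib]

theorem heat_smul (d : K → B) (a : B) (D : K → Sym2 ι → B) :
    heat d (a • D) = a • heat d D := by
  refine LinearMap.ext fun m => ?_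
  simp only [heat_apply, LinearMap.smul_apply, Pi.smul_apply, smul_eq_mul, mul_smul, Finset.smul_sum]

/-- A summand `E` of the covariance whose heat operator kills `m` does not contribute, since heat operators
commute. -/
theorem expectation_add_of_heat_eq_zero (d : K → B) (D E : K → Sym2 ι → B) {m : MvPolynomial (K × Sym2 ι) B}
    (hm : heat d E m = 0) (n : ℕ) : expectation d (D + E) n m = expectation d D n m := by
  have hc : heat d E * heat d D = heat d D * heat d E := by
    have := heat_comm d E D
    rwa [Ring.lie_def, sub_eq_zero] at this
  have hc' : ∀ n : ℕ, heat d E ((heat d D ^ n) m) = 0 := fun n => by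
    have h := (Commute.pow_right (show Commute (heat d E) (heat d D) from hc) n).eq
    have h' := congrArg (fun T => T m) h
    simpa [Module.End.mul_apply, hm] using h'
  have h : (heat d (D + E) ^ n) m = (heat d D ^ n) m := by
    induction n with
    | zero => simp
    | succ n ih =>
      rw [pow_succ', pow_succ', Module.End.mul_apply, Module.End.mul_apply, ih, heat_add, LinearMap.add_apply,
        hc', add_zero]
  rw [expectation, expectation, h]

theorem map_heat (φ : B →+* B') (d : K → B) (D : K → Sym2 ι → B) (m : MvPolynomial (K × Sym2 ι) B) :
    MvPolynomial.map φ (heat d D m) =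
      heat (fun c => φ (d c)) (fun c u => φ (D c u)) (MvPolynomial.map φ m) := by
  have h1 : ∀ (c : K) (α β : ι) (m : MvPolynomial (K × Sym2 ι) B), MvPolynomial.map φ (linkDeriv B c α β m) =
      linkDeriv B' c α β (MvPolynomial.map φ m) := fun c α β m => by
    rw [linkDeriv_apply, linkDeriv_apply, MvPolynomial.pderiv_map, MvPolynomial.smul_eq_C_mul,
      MvPolynomial.smul_eq_C_mul, map_mul, MvPolynomial.map_C, apply_ite φ, map_one, map_ofNat]
  simp only [heat_apply, contraction, LinearMap.add_apply, LinearMap.smul_apply, LinearMap.sum_apply,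
    Module.End.mul_apply, linkMul_apply, MvPolynomial.smul_eq_C_mul, map_sum, map_mul, map_add, MvPolynomial.map_C,
    MvPolynomial.map_X, h1]

theorem map_expectation (φ : B →+* B') (d : K → B) (D : K → Sym2 ι → B) (n : ℕ)
    (m : MvPolynomial (K × Sym2 ι) B) :
    φ (expectation d D n m) =
      expectation (fun c => φ (d c)) (fun c u => φ (D c u)) n (MvPolynomial.map φ m) := by
  have h : MvPolynomial.map φ ((heat d D ^ n) m) =
      (heat (fun c => φ (d c)) (fun c u => φ (D c u)) ^ n) (MvPolynomial.map φ m) := by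
    induction n with
    | zero => simp
    | succ n ih => rw [pow_succ', pow_succ', Module.End.mul_apply, Module.End.mul_apply, map_heat, ih]
  rw [expectation, expectation, ← h, MvPolynomial.constantCoeff_map]

theorem map_colorSum (φ : B →+* B') (P : MvPolynomial (Sym2 ι) B) :
    MvPolynomial.map φ (colorSum K P) = colorSum K (MvPolynomial.map φ P) := by
  induction P using MvPolynomial.induction_on with
  | C a => simp [colorSum]
  | add p q hp hq => simp only [map_add, hp, hq]
  | mul_X p v hp => simp only [map_mul, hp, MvPolynomial.map_X, colorSum_X, map_sum]

end Colors

/-! ### Multidegrees -/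

section Weights

variable {ι : Type*} [DecidableEq ι] {R : Type*} [CommRing R]

/-- The multidegree in `ι → ℤ` of `X^{αβ}`, so that the coordinate at `γ` counts how often `γ` occurs. It takes values in
`ℤ` rather than `ℕ` because derivatives are graded by subtraction. Being homogeneous with underlying set the whole of `ι` is the
same as being homogeneous of multidegree `1`. -/
def linkWeight : Sym2 ι → ι → ℤ :=
  Sym2.lift ⟨fun α β => Pi.single α 1 + Pi.single β 1, fun _ _ => add_comm _ _⟩

theorem linkWeight_mk (α β : ι) : linkWeight s(α, β) = Pi.single α 1 + Pi.single β 1 := rfl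

theorem linkWeight_nonneg (u : Sym2 ι) (α : ι) : 0 ≤ linkWeight u α := by
  induction u with | _ β γ =>
  simp only [linkWeight_mk, Pi.add_apply, Pi.single_apply]
  split_ifs <;> norm_num

theorem linkWeight_of_notMem {u : Sym2 ι} {α : ι} (h : α ∉ u) : linkWeight u α = 0 := by
  induction u with | _ β γ =>
  rw [Sym2.mem_iff, not_or] at h
  simp [linkWeight_mk, h.1, h.2]

theorem one_le_linkWeight {u : Sym2 ι} {α : ι} (h : α ∈ u) : 1 ≤ linkWeight u α := by
  induction u with | _ β γ =>
  rw [Sym2.mem_iff] at h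
  simp only [linkWeight_mk, Pi.add_apply, Pi.single_apply]
  rcases h with h | h <;> simp only [h, if_true] <;> split_ifs <;> norm_num

theorem linkWeight_of_mem {u : Sym2 ι} {α : ι} (h : α ∈ u) (hu : ¬ u.IsDiag) : linkWeight u α = 1 := by
  induction u with | _ β γ =>
  rw [Sym2.mem_iff] at h
  rw [Sym2.mk_isDiag_iff] at hu
  simp only [linkWeight_mk, Pi.add_apply, Pi.single_apply]
  rcases h with h | h
  · simp [h, hu]
  · simp [h, Ne.symm hu]

theorem linkWeight_of_isDiag {u : Sym2 ι} (hu : u.IsDiag) : ∃ α, linkWeight u α = 2 := by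
  induction u with | _ β γ =>
  rw [Sym2.mk_isDiag_iff] at hu
  exact ⟨β, by simp [linkWeight_mk, hu, one_add_one_eq_two]⟩

theorem weight_linkWeight_apply (m : Sym2 ι →₀ ℕ) (α : ι) :
    Finsupp.weight linkWeight m α = ∑ u ∈ m.support, (m u : ℤ) * linkWeight u α := by
  rw [Finsupp.weight_apply, Finsupp.sum, Finset.sum_apply]
  simp

theorem isWeightedHomogeneous_of_isHomogeneousOn {P : MvPolynomial (Sym2 ι) R}
    (hP : IsHomogeneousOn Set.univ P) : MvPolynomial.IsWeightedHomogeneous linkWeight P (1 : ι → ℤ) := by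
  rw [← MvPolynomial.mem_weightedHomogeneousSubmodule]
  refine Submodule.span_le.mpr ?_ hP
  rintro _ ⟨L, hL, hLu, rfl⟩
  rw [SetLike.mem_coe, MvPolynomial.mem_weightedHomogeneousSubmodule]
  have h := MvPolynomial.IsWeightedHomogeneous.prod (R := R) L MvPolynomial.X linkWeight
    (fun u _ => MvPolynomial.isWeightedHomogeneous_X R linkWeight u)
  have h1 : ∑ u ∈ L, linkWeight u = (1 : ι → ℤ) := by
    funext α
    obtain ⟨u, hu, hαu⟩ : α ∈ underlying L := by rw [hLu]; trivial
    rw [Finset.sum_apply, Finset.sum_eq_single u, linkWeight_of_mem hαu (hL.1 u hu), Pi.one_apply]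
    · intro v hv hvu
      exact linkWeight_of_notMem fun hαv => hvu (hL.2 v hv u hu α hαv hαu)
    · exact fun h => absurd hu h
  rwa [h1] at h

theorem monomial_eq_linkMonomial {m : Sym2 ι →₀ ℕ} (hm : Finsupp.weight linkWeight m = (1 : ι → ℤ)) :
    IsLinkSet m.support ∧ underlying m.support = Set.univ ∧
      MvPolynomial.monomial m (1 : R) = linkMonomial R m.support := by
  have hα : ∀ α, ∑ u ∈ m.support, (m u : ℤ) * linkWeight u α = 1 := fun α => by
    rw [← weight_linkWeight_apply, hm, Pi.one_apply]
  have hle : ∀ u ∈ m.support, ∀ α, (m u : ℤ) * linkWeight u α ≤ 1 := fun u hu α => by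
    rw [← hα α]
    exact Finset.single_le_sum (f := fun u => (m u : ℤ) * linkWeight u α)
      (fun v _ => mul_nonneg (Int.natCast_nonneg _) (linkWeight_nonneg v α)) hu
  have hpos : ∀ u ∈ m.support, (1 : ℤ) ≤ m u := fun u hu => by
    have := Finsupp.mem_support_iff.mp hu; omega
  refine ⟨⟨fun u hu hd => ?_, fun u hu v hv α hαu hαv => ?_⟩, ?_, ?_⟩
  · obtain ⟨α, h2⟩ := linkWeight_of_isDiag hd
    have := hle u hu α
    have := hpos u hu
    rw [h2] at *; omega
  · by_contra huv
    have h := hα α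
    rw [← Finset.add_sum_erase _ _ hu, ← Finset.add_sum_erase _ _ (Finset.mem_erase.mpr ⟨Ne.symm huv, hv⟩)] at h
    have h0 : 0 ≤ ∑ x ∈ (m.support.erase u).erase v, (m x : ℤ) * linkWeight x α :=
      Finset.sum_nonneg fun x _ => mul_nonneg (Int.natCast_nonneg _) (linkWeight_nonneg x α)
    have h1 := hpos u hu
    have h2 := hpos v hv
    have h3 := one_le_linkWeight hαu
    have h4 := one_le_linkWeight hαv
    nlinarith
  · refine Set.eq_univ_of_forall fun α => ?_
    by_contra hno
    have h := hα α
    rw [Finset.sum_eq_zero] at h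
    · exact absurd h (by norm_num)
    · intro u hu
      rw [linkWeight_of_notMem fun hαu => hno ⟨u, hu, hαu⟩, mul_zero]
  · rw [linkMonomial, MvPolynomial.monomial_eq, Finsupp.prod, map_one, one_mul]
    refine Finset.prod_congr rfl fun u hu => ?_
    have h1 : m u = 1 := by
      have h2 := hpos u hu
      obtain ⟨α, hα⟩ : ∃ α, α ∈ u := by
        induction u with | _ β γ => exact ⟨β, Sym2.mem_mk_left β γ⟩
      have h3 := hle u hu α
      have h4 := one_le_linkWeight hα
      have : (m u : ℤ) ≤ 1 := by nlinarith
      omega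
    rw [h1, pow_one]

theorem isHomogeneousOn_of_isWeightedHomogeneous {P : MvPolynomial (Sym2 ι) R}
    (hP : MvPolynomial.IsWeightedHomogeneous linkWeight P (1 : ι → ℤ)) : IsHomogeneousOn Set.univ P := by
  rw [IsHomogeneousOn, P.as_sum]
  refine Submodule.sum_mem _ fun m hm => ?_
  obtain ⟨h1, h2, h3⟩ := monomial_eq_linkMonomial (R := R) (hP (MvPolynomial.mem_support_iff.mp hm))
  rw [← mul_one (P.coeff m), ← smul_eq_mul, ← MvPolynomial.smul_monomial, h3]
  exact Submodule.smul_mem _ _ (Submodule.subset_span ⟨_, h1, h2, rfl⟩)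

theorem degree_of_weight_eq_one [Fintype ι] {m : Sym2 ι →₀ ℕ}
    (hm : Finsupp.weight linkWeight m = (1 : ι → ℤ)) : 2 * m.degree = Fintype.card ι := by
  have h : ∑ α, Finsupp.weight linkWeight m α = (Fintype.card ι : ℤ) := by simp [hm]
  have h2 : ∀ u : Sym2 ι, ∑ α, linkWeight u α = 2 := fun u => by
    induction u with | _ β γ =>
    simp [linkWeight_mk, Finset.sum_add_distrib]
  simp only [weight_linkWeight_apply] at h
  rw [Finset.sum_comm] at h
  simp only [← Finset.mul_sum, h2] at h
  rw [← Finset.sum_mul] at h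
  rw [Finsupp.degree_apply]
  zify
  simpa [mul_comm] using h

theorem eq_zero_of_weight_neg {P : MvPolynomial (Sym2 ι) R} {w : ι → ℤ}
    (hP : MvPolynomial.IsWeightedHomogeneous linkWeight P w) {α : ι} (hα : w α < 0) : P = 0 := by
  refine MvPolynomial.ext _ _ fun m => ?_
  by_contra h
  have h1 := congrFun (hP h) α
  have h2 : 0 ≤ Finsupp.weight linkWeight m α := by
    rw [weight_linkWeight_apply]
    exact Finset.sum_nonneg fun u _ => mul_nonneg (Int.natCast_nonneg _) (linkWeight_nonneg u α)
  omega

theorem isWeightedHomogeneous_pderiv {P : MvPolynomial (Sym2 ι) R} {w : ι → ℤ}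
    (hP : MvPolynomial.IsWeightedHomogeneous linkWeight P w) (u : Sym2 ι) :
    MvPolynomial.IsWeightedHomogeneous linkWeight (MvPolynomial.pderiv u P) (w - linkWeight u) :=
  hP.pderiv (sub_add_cancel _ _)

theorem pderiv_diag_eq_zero {P : MvPolynomial (Sym2 ι) R}
    (hP : MvPolynomial.IsWeightedHomogeneous linkWeight P (1 : ι → ℤ)) (γ : ι) :
    MvPolynomial.pderiv s(γ, γ) P = 0 :=
  eq_zero_of_weight_neg (α := γ) (isWeightedHomogeneous_pderiv hP _) (by simp [linkWeight_mk])

theorem pderiv_pderiv_eq_zero {P : MvPolynomial (Sym2 ι) R}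
    (hP : MvPolynomial.IsWeightedHomogeneous linkWeight P (1 : ι → ℤ)) (γ μ ν : ι) :
    MvPolynomial.pderiv s(γ, μ) (MvPolynomial.pderiv s(γ, ν) P) = 0 := by
  refine eq_zero_of_weight_neg (α := γ) (isWeightedHomogeneous_pderiv (isWeightedHomogeneous_pderiv hP _) _) ?_
  simp only [linkWeight_mk, Pi.sub_apply, Pi.add_apply, Pi.one_apply, Pi.single_apply, if_true]
  split_ifs <;> norm_num

end Weights

/-! ### Pluri-harmonic polynomials -/

section Harmonic

variable {K ι : Type*} [DecidableEq K] [DecidableEq ι] [Fintype K] [Fintype ι]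

theorem contraction_colorSum_of_ne {P : MvPolynomial (Sym2 ι) ℂ}
    (hP : MvPolynomial.IsWeightedHomogeneous linkWeight P (1 : ι → ℤ)) (d : K → ℂ) {γ δ : ι} (h : γ ≠ δ) :
    ∑ c, contraction (d c) (linkMul ℂ c) (linkDeriv ℂ c) γ δ (colorSum K P) =
      colorSum K (laplacian (∑ c, d c) γ δ P) := by
  rw [contraction_colorSum, laplacian, if_neg h, one_smul]
  refine congrArg (colorSum K) (congrArg₂ (· + ·) rfl ?_)
  refine Finset.sum_congr rfl fun μ _ => Finset.sum_congr rfl fun ν _ =>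
    congrArg₂ (· * ·) rfl ?_
  by_cases h1 : δ = ν
  · subst h1
    rw [pderiv_diag_eq_zero hP, smul_zero, map_zero, smul_zero]
  · rw [if_neg h1, one_smul]
    by_cases h2 : γ = μ
    · subst h2
      rw [pderiv_comm, pderiv_diag_eq_zero hP, map_zero, smul_zero]
    · rw [if_neg h2, one_smul]

theorem contraction_colorSum_self {P : MvPolynomial (Sym2 ι) ℂ}
    (hP : MvPolynomial.IsWeightedHomogeneous linkWeight P (1 : ι → ℤ)) (d : K → ℂ) (γ : ι) :
    ∑ c, contraction (d c) (linkMul ℂ c) (linkDeriv ℂ c) γ γ (colorSum K P) = 0 := by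
  rw [contraction_colorSum, pderiv_diag_eq_zero hP]
  simp only [Derivation.map_smul, pderiv_pderiv_eq_zero hP, smul_zero, mul_zero, Finset.sum_const_zero, add_zero,
    map_zero]

/-- Pluri-harmonicity in the total dimension kills the heat operator of a covariance that is the same in all colours and
vanishes between starred and lower-starred indices: what remains are Laplacians inside one of the two groups, and the contractions of
an index with itself, which vanish by multilinearity. -/
theorem heat_colorSum_eq_zero {l : ℕ} {P : MvPolynomial (Sym2 (Fin l ⊕ Fin l)) ℂ} (d : K → ℂ)
    (hP : MvPolynomial.IsWeightedHomogeneous linkWeight P (1 : (Fin l ⊕ Fin l) → ℤ))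
    (hharm : IsPluriharmonic (∑ c, d c) P) (E : Sym2 (Fin l ⊕ Fin l) → ℂ)
    (hE : ∀ a b, E s(Sum.inl a, Sum.inr b) = 0) : heat d (fun _ => E) (colorSum K P) = 0 := by
  rw [heat_apply, Finset.sum_comm]
  refine Finset.sum_eq_zero fun γ _ => ?_
  rw [Finset.sum_comm]
  refine Finset.sum_eq_zero fun δ _ => ?_
  rw [← Finset.smul_sum]
  by_cases h : γ = δ
  · subst h
    rw [contraction_colorSum_self hP, smul_zero]
  · rw [contraction_colorSum_of_ne hP d h]
    rcases γ with a | a <;> rcases δ with b | b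
    · rw [hharm.1 a b (fun e => h (by rw [e])), map_zero, smul_zero]
    · rw [hE, zero_smul]
    · rw [Sym2.eq_swap, hE, zero_smul]
    · rw [hharm.2 a b (fun e => h (by rw [e])), map_zero, smul_zero]

end Harmonic

/-! ### Homogeneity of moments -/

section Grading

variable {K ι : Type*} [DecidableEq K] [DecidableEq ι] [Fintype K] [Fintype ι] {S : Type*} [CommRing S]

/-- Homogeneity of multidegree `w` when both the variables `X_c^{αβ}` and the variables `X^{αβ}` of the coefficient ring
have multidegree `linkWeight`. -/
def IsJointlyHomogeneous (w : ι → ℤ) (m : MvPolynomial (K × Sym2 ι) (MvPolynomial (Sym2 ι) S)) : Prop :=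
  ∀ n, MvPolynomial.IsWeightedHomogeneous linkWeight (m.coeff n)
    (w - Finsupp.weight (fun i : K × Sym2 ι => linkWeight i.2) n)

namespace IsJointlyHomogeneous

variable {w : ι → ℤ} {m m' : MvPolynomial (K × Sym2 ι) (MvPolynomial (Sym2 ι) S)}

theorem add (h : IsJointlyHomogeneous w m) (h' : IsJointlyHomogeneous w m') :
    IsJointlyHomogeneous w (m + m') := fun n => by
  rw [MvPolynomial.coeff_add]; exact (h n).add (h' n)

theorem zero : IsJointlyHomogeneous w (0 : MvPolynomial (K × Sym2 ι) (MvPolynomial (Sym2 ι) S)) := fun n => by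
  rw [MvPolynomial.coeff_zero]; exact MvPolynomial.isWeightedHomogeneous_zero _ _ _

theorem sum {κ : Type*} (t : Finset κ) (f : κ → MvPolynomial (K × Sym2 ι) (MvPolynomial (Sym2 ι) S))
    (h : ∀ i ∈ t, IsJointlyHomogeneous w (f i)) : IsJointlyHomogeneous w (∑ i ∈ t, f i) :=
  Finset.sum_induction _ _ (fun _ _ => add) zero h

theorem mul {v : ι → ℤ} (h : IsJointlyHomogeneous v m) (h' : IsJointlyHomogeneous w m') :
    IsJointlyHomogeneous (v + w) (m * m') := fun n => by
  rw [MvPolynomial.coeff_mul]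
  refine MvPolynomial.IsWeightedHomogeneous.sum _ _ _ fun x hx => ?_
  rw [← Finset.HasAntidiagonal.mem_antidiagonal.mp hx, map_add, add_sub_add_comm]
  exact (h x.1).mul (h' x.2)

theorem C {b : MvPolynomial (Sym2 ι) S} {v : ι → ℤ} (hb : MvPolynomial.IsWeightedHomogeneous linkWeight b v) :
    IsJointlyHomogeneous v (MvPolynomial.C b : MvPolynomial (K × Sym2 ι) (MvPolynomial (Sym2 ι) S)) := fun n => by
  rw [MvPolynomial.coeff_C]
  split_ifs with h
  · rwa [← h, map_zero, sub_zero]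
  · exact MvPolynomial.isWeightedHomogeneous_zero _ _ _

theorem X (i : K × Sym2 ι) : IsJointlyHomogeneous (linkWeight i.2)
    (MvPolynomial.X i : MvPolynomial (K × Sym2 ι) (MvPolynomial (Sym2 ι) S)) := fun n => by
  rw [MvPolynomial.coeff_X]
  split_ifs with h
  · rw [← h, Finsupp.weight_single, one_smul, sub_self]
    exact MvPolynomial.isWeightedHomogeneous_one _ _
  · exact MvPolynomial.isWeightedHomogeneous_zero _ _ _

theorem smul {b : MvPolynomial (Sym2 ι) S} {v : ι → ℤ} (hb : MvPolynomial.IsWeightedHomogeneous linkWeight b v)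
    (h : IsJointlyHomogeneous w m) : IsJointlyHomogeneous (v + w) (b • m) := by
  rw [MvPolynomial.smul_eq_C_mul]
  exact (C hb).mul h

theorem pderiv (i : K × Sym2 ι) (h : IsJointlyHomogeneous w m) :
    IsJointlyHomogeneous (w - linkWeight i.2) (MvPolynomial.pderiv i m) := fun n => by
  rw [MvPolynomial.coeff_pderiv]
  have h1 := h (n + Finsupp.single i 1)
  have h2 : MvPolynomial.IsWeightedHomogeneous linkWeight ((n i : MvPolynomial (Sym2 ι) S) + 1) (0 : ι → ℤ) := by
    have := MvPolynomial.isWeightedHomogeneous_C (linkWeight (ι := ι)) ((n i : S) + 1)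
    rwa [map_add, map_natCast, map_one] at this
  have h3 := h1.mul h2
  rwa [map_add, Finsupp.weight_single, one_smul, add_zero, add_comm (Finsupp.weight _ _), ← sub_sub] at h3

theorem linkDeriv (c : K) (α β : ι) (h : IsJointlyHomogeneous w m) :
    IsJointlyHomogeneous (w - linkWeight s(α, β)) (linkDeriv (MvPolynomial (Sym2 ι) S) c α β m) := by
  rw [linkDeriv_apply]
  have h0 : MvPolynomial.IsWeightedHomogeneous linkWeight (if α = β then 2 else 1 : MvPolynomial (Sym2 ι) S)
      (0 : ι → ℤ) := by
    rw [show (if α = β then 2 else 1 : MvPolynomial (Sym2 ι) S) = MvPolynomial.C (if α = β then 2 else 1) by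
      rw [apply_ite MvPolynomial.C, map_one, map_ofNat]]
    exact MvPolynomial.isWeightedHomogeneous_C _ _
  have := smul h0 (h.pderiv (c, s(α, β)))
  rwa [zero_add] at this

theorem heat {d : K → MvPolynomial (Sym2 ι) S} {D : K → Sym2 ι → MvPolynomial (Sym2 ι) S}
    (hd : ∀ c, MvPolynomial.IsWeightedHomogeneous linkWeight (d c) (0 : ι → ℤ))
    (hD : ∀ c u, MvPolynomial.IsWeightedHomogeneous linkWeight (D c u) (linkWeight u))
    (h : IsJointlyHomogeneous w m) : IsJointlyHomogeneous w (SiegelPullback.heat d D m) := by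
  rw [heat_apply]
  refine sum _ _ fun c _ => sum _ _ fun γ _ => sum _ _ fun δ _ => ?_
  rw [show w = linkWeight s(γ, δ) + (w - linkWeight s(γ, δ)) by abel]
  refine smul (hD _ _) ?_
  simp only [contraction, LinearMap.add_apply, LinearMap.smul_apply, LinearMap.sum_apply, Module.End.mul_apply,
    linkMul_apply]
  refine add ?_ (sum _ _ fun μ _ => sum _ _ fun ν _ => ?_)
  · have := smul (hd c) (h.linkDeriv c γ δ)
    rwa [zero_add] at this
  · have := (X (c, s(μ, ν))).mul ((h.linkDeriv c δ ν).linkDeriv c γ μ)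
    convert this using 1
    simp only [linkWeight_mk]
    abel

theorem expectation {d : K → MvPolynomial (Sym2 ι) S} {D : K → Sym2 ι → MvPolynomial (Sym2 ι) S}
    (hd : ∀ c, MvPolynomial.IsWeightedHomogeneous linkWeight (d c) (0 : ι → ℤ))
    (hD : ∀ c u, MvPolynomial.IsWeightedHomogeneous linkWeight (D c u) (linkWeight u))
    (h : IsJointlyHomogeneous w m) (n : ℕ) :
    MvPolynomial.IsWeightedHomogeneous linkWeight (SiegelPullback.expectation d D n m) w := by
  have h1 : IsJointlyHomogeneous w ((SiegelPullback.heat d D ^ n) m) := by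
    induction n with
    | zero => simpa using h
    | succ n ih => rw [pow_succ', Module.End.mul_apply]; exact ih.heat hd hD
  have h2 := h1 0
  rwa [map_zero, sub_zero] at h2

theorem colorSum_monomial (n : Sym2 ι →₀ ℕ) :
    IsJointlyHomogeneous (Finsupp.weight linkWeight n)
      (colorSum K (MvPolynomial.monomial n (1 : MvPolynomial (Sym2 ι) S))) := by
  have h1 : IsJointlyHomogeneous (0 : ι → ℤ) (1 : MvPolynomial (K × Sym2 ι) (MvPolynomial (Sym2 ι) S)) :=
    C (MvPolynomial.isWeightedHomogeneous_one S linkWeight)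
  induction n using Finsupp.induction_linear with
  | zero =>
    rw [map_zero, MvPolynomial.monomial_zero', map_one, map_one]
    exact h1
  | add f g hf hg =>
    rw [map_add, ← one_mul (1 : MvPolynomial (Sym2 ι) S), ← MvPolynomial.monomial_mul, map_mul]
    exact hf.mul hg
  | single u k =>
    rw [Finsupp.weight_single, ← MvPolynomial.X_pow_eq_monomial, map_pow, colorSum_X]
    induction k with
    | zero => rw [zero_smul, pow_zero]; exact h1
    | succ k ih =>
      rw [succ_nsmul, pow_succ]
      exact ih.mul (sum _ _ fun c _ => X (c, u))

theorem colorSum_map {S₀ : Type*} [CommRing S₀] (f : S₀ →+* S) {P : MvPolynomial (Sym2 ι) S₀}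
    (hP : MvPolynomial.IsWeightedHomogeneous linkWeight P w) :
    IsJointlyHomogeneous w (colorSum K (MvPolynomial.map (MvPolynomial.C.comp f) P) :
      MvPolynomial (K × Sym2 ι) (MvPolynomial (Sym2 ι) S)) := by
  rw [P.as_sum, map_sum, map_sum]
  refine sum _ _ fun n hn => ?_
  have h := smul (MvPolynomial.isWeightedHomogeneous_C (linkWeight (ι := ι)) (f (P.coeff n)))
    (colorSum_monomial (K := K) n)
  rw [hP (MvPolynomial.mem_support_iff.mp hn), zero_add, ← map_smul, MvPolynomial.smul_monomial, smul_eq_mul,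
    mul_one] at h
  rwa [MvPolynomial.map_monomial]

end IsJointlyHomogeneous
end Grading

/-! ### Matrix calculus on the Siegel upper half space -/

section MatrixCalculus

variable {n : Type*} [Fintype n] [DecidableEq n]

/-- Jacobi's formula, from the expansion of `det (1 + z M⁻¹ N)` to first order. -/
theorem hasDerivAt_det_add_smul {𝕜 : Type*} [NontriviallyNormedField 𝕜] (M N : Matrix n n 𝕜) (hM : IsUnit M.det) :
    HasDerivAt (fun z : 𝕜 => (M + z • N).det) (M.det * (M⁻¹ * N).trace) 0 := by
  have h1 : ∀ z : 𝕜, (M + z • N).det = M.det * (1 + (M⁻¹ * N).trace * z +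
      (Matrix.det (1 + (Polynomial.X : Polynomial 𝕜) • (M⁻¹ * N).map Polynomial.C)).divX.divX.eval z * z ^ 2) :=
    fun z => by
      rw [← Matrix.det_one_add_smul, ← Matrix.det_mul, mul_add, mul_one, mul_smul_comm,
        Matrix.mul_nonsing_inv_cancel_left _ _ hM]
  simp only [h1]
  refine HasDerivAt.const_mul _ ?_
  have h2 := ((hasDerivAt_id (0 : 𝕜)).const_mul (M⁻¹ * N).trace).const_add 1
  have h3 := ((Matrix.det (1 + (Polynomial.X : Polynomial 𝕜) • (M⁻¹ * N).map Polynomial.C)).divX.divX.hasDerivAt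
    (0 : 𝕜)).mul ((hasDerivAt_id (0 : 𝕜)).pow 2)
  have h4 := h2.add h3
  simpa using! h4

open scoped Matrix.Norms.Operator in
theorem hasDerivAt_inv_add_smul {𝕜 : Type*} [RCLike 𝕜] (M N : Matrix n n 𝕜) (hM : IsUnit M.det) (i j : n) :
    HasDerivAt (fun z : 𝕜 => (M + z • N)⁻¹ i j) (-(M⁻¹ * N * M⁻¹) i j) 0 := by
  obtain ⟨u, hu⟩ := (Matrix.isUnit_iff_isUnit_det M).mpr hM
  have hui : (↑u⁻¹ : Matrix n n 𝕜) = M⁻¹ := by rw [Matrix.coe_units_inv, hu]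
  have h1 := hasFDerivAt_ringInverse (𝕜 := 𝕜) u
  have h2 : HasDerivAt (fun z : 𝕜 => M + z • N) N 0 := by
    exact (((hasDerivAt_id (0 : 𝕜)).smul_const N).const_add M).congr_deriv (one_smul _ _)
  rw [show (u : Matrix n n 𝕜) = M + (0 : 𝕜) • N by rw [hu, zero_smul, add_zero]] at h1
  have h3 := h1.comp_hasDerivAt (0 : 𝕜) h2
  rw [hui] at h3
  have h4 := (LinearMap.toContinuousLinearMap (Matrix.entryLinearMap 𝕜 𝕜 i j)).hasFDerivAt.comp_hasDerivAt (0 : 𝕜) h3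
  simpa [Function.comp_def, Matrix.nonsing_inv_eq_ringInverse] using! h4

/-- Positive definiteness is an open condition on symmetric matrices, by compactness of the unit sphere. -/
theorem eventually_posDef_add_smul {Y S : Matrix n n ℝ} (hY : Y.PosDef) (hS : S.IsSymm) :
    ∀ᶠ t : ℝ in nhds 0, (Y + t • S).PosDef := by
  have hcont : Continuous fun z : ℝ × (n → ℝ) => z.2 ⬝ᵥ ((Y + z.1 • S) *ᵥ z.2) := by fun_prop
  have h := (isCompact_sphere (0 : n → ℝ) 1).eventually_forall_of_forall_eventually (x₀ := (0 : ℝ))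
    (P := fun t v => 0 < v ⬝ᵥ ((Y + t • S) *ᵥ v)) (fun v hv => by
      have hv0 : v ≠ 0 := by
        rintro rfl
        simp at hv
      have h0 : 0 < v ⬝ᵥ ((Y + (0 : ℝ) • S) *ᵥ v) := by
        rw [zero_smul, add_zero]
        simpa using hY.dotProduct_mulVec_pos hv0
      exact hcont.continuousAt.eventually (lt_mem_nhds h0))
  filter_upwards [h] with t ht
  refine Matrix.PosDef.of_dotProduct_mulVec_pos ?_ fun v hv => ?_
  · have h1 : Yᵀ = Y := by rw [← Matrix.conjTranspose_eq_transpose_of_trivial]; exact hY.isHermitian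
    rw [Matrix.IsHermitian, Matrix.conjTranspose_eq_transpose_of_trivial, Matrix.transpose_add,
      Matrix.transpose_smul, hS.eq, h1]
  · have hn : 0 < ‖v‖ := norm_pos_iff.mpr hv
    have h2 := ht (‖v‖⁻¹ • v) (by simp [norm_smul, hn.ne'])
    rw [Matrix.mulVec_smul, smul_dotProduct, dotProduct_smul, smul_eq_mul, smul_eq_mul] at h2
    have hi : 0 < ‖v‖⁻¹ := inv_pos.mpr hn
    simpa using (pos_of_mul_pos_right (pos_of_mul_pos_right h2 hi.le) hi.le)

theorem map_im_isSymm {H : Matrix n n ℂ} (hH : H.IsSymm) : (H.map Complex.im).IsSymm := by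
  rw [Matrix.IsSymm, ← Matrix.transpose_map, hH.eq]

theorem map_im_add_smul (Z H : Matrix n n ℂ) (t : ℝ) :
    (Z + t • H).map Complex.im = Z.map Complex.im + t • H.map Complex.im := by
  ext i j; simp

theorem eventually_mem_siegelUpperHalfSpace {Z H : Matrix n n ℂ} (hZ : Z ∈ siegelUpperHalfSpace n) (hH : H.IsSymm) :
    ∀ᶠ t : ℝ in nhds 0, Z + t • H ∈ siegelUpperHalfSpace n := by
  filter_upwards [eventually_posDef_add_smul hZ.2 (map_im_isSymm hH)] with t ht
  exact ⟨hZ.1.add (hH.smul t), by rwa [map_im_add_smul]⟩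

theorem re_star_dotProduct_map_ofReal_mulVec (Y : Matrix n n ℝ) (v : n → ℂ) :
    (star v ⬝ᵥ (Y.map Complex.ofReal *ᵥ v)).re =
      (fun i => (v i).re) ⬝ᵥ (Y *ᵥ fun i => (v i).re) + (fun i => (v i).im) ⬝ᵥ (Y *ᵥ fun i => (v i).im) := by
  simp only [dotProduct, Matrix.mulVec, Complex.re_sum, ← Finset.sum_add_distrib, Finset.mul_sum]
  refine Finset.sum_congr rfl fun i _ => Finset.sum_congr rfl fun j _ => ?_
  simp

/-- With `M = CZ + D` and `N = AZ + B` one has `Mᴴ N - Nᴴ M = Z - Zᴴ = 2i Im Z`, so `M v = 0` forces `v = 0`. -/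
theorem isUnit_det_autoFactor {g : Matrix (n ⊕ n) (n ⊕ n) ℝ} (hg : g ∈ Matrix.symplecticGroup n ℝ)
    {Z : Matrix n n ℂ} (hZ : Z ∈ siegelUpperHalfSpace n) : IsUnit (autoFactor g Z).det := by
  have hgC := SymplecticGroup.map_mem hg Complex.ofRealHom
  rw [← Matrix.fromBlocks_toBlocks g, Matrix.fromBlocks_map, SymplecticGroup.fromBlocks_mem_iff] at hgC
  obtain ⟨hAC, hBD, hAD⟩ := hgC
  have hreal : ∀ T : Matrix n n ℝ, (T.map Complex.ofRealHom)ᴴ = (T.map Complex.ofRealHom)ᵀ := fun T => by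
    ext i j; simp
  have hM : autoFactor g Z = g.toBlocks₂₁.map Complex.ofRealHom * Z + g.toBlocks₂₂.map Complex.ofRealHom := rfl
  have hAH := hreal g.toBlocks₁₁
  have hBH := hreal g.toBlocks₁₂
  have hCH := hreal g.toBlocks₂₁
  have hDH := hreal g.toBlocks₂₂
  generalize g.toBlocks₁₁.map Complex.ofRealHom = A at *
  generalize g.toBlocks₁₂.map Complex.ofRealHom = B at *
  generalize g.toBlocks₂₁.map Complex.ofRealHom = C at *
  generalize g.toBlocks₂₂.map Complex.ofRealHom = D at *
  have hDA : Dᵀ * A - Bᵀ * C = 1 := by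
    simpa [Matrix.transpose_sub, Matrix.transpose_mul] using congrArg Matrix.transpose hAD
  have hkey : (C * Z + D)ᴴ * (A * Z + B) - (A * Z + B)ᴴ * (C * Z + D) = Z - Zᴴ := by
    simp only [Matrix.conjTranspose_add, Matrix.conjTranspose_mul, hAH, hBH, hCH, hDH]
    calc _ = Zᴴ * (Cᵀ * A - Aᵀ * C) * Z - Zᴴ * (Aᵀ * D - Cᵀ * B) + (Dᵀ * A - Bᵀ * C) * Z
          + (Dᵀ * B - Bᵀ * D) := by noncomm_ring
      _ = _ := by rw [hAC, hBD, hAD, hDA]; noncomm_ring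
  have hIm : Z - Zᴴ = (2 * Complex.I) • (Z.map Complex.im).map Complex.ofReal := by
    ext i j
    have hs : Z j i = Z i j := hZ.1.apply i j
    simp only [Matrix.sub_apply, Matrix.conjTranspose_apply, hs, Matrix.smul_apply, Matrix.map_apply, smul_eq_mul]
    apply Complex.ext <;> simp
    ring
  rw [isUnit_iff_ne_zero]
  intro h0
  obtain ⟨v, hv, hMv⟩ := Matrix.exists_mulVec_eq_zero_iff.mpr h0
  rw [hM] at hMv
  have h1 : star v ⬝ᵥ ((Z - Zᴴ) *ᵥ v) = 0 := by
    rw [← hkey, Matrix.sub_mulVec, ← Matrix.mulVec_mulVec, ← Matrix.mulVec_mulVec, hMv, Matrix.mulVec_zero, sub_zero,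
      Matrix.dotProduct_mulVec, ← Matrix.star_mulVec, hMv, star_zero, zero_dotProduct]
  rw [hIm, Matrix.smul_mulVec, dotProduct_smul, smul_eq_mul, mul_eq_zero] at h1
  have h2 := congrArg Complex.re (h1.resolve_left (by simp))
  rw [re_star_dotProduct_map_ofReal_mulVec, Complex.zero_re] at h2
  have hnn : ∀ w : n → ℝ, 0 ≤ w ⬝ᵥ (Z.map Complex.im *ᵥ w) := fun w => by
    by_cases hw : w = 0
    · simp [hw]
    · simpa using (hZ.2.dotProduct_mulVec_pos hw).le
  have hz : ∀ w : n → ℝ, w ⬝ᵥ (Z.map Complex.im *ᵥ w) = 0 → w = 0 := fun w hw => by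
    by_contra hw0
    have := hZ.2.dotProduct_mulVec_pos hw0
    simp [hw] at this
  have hre := hz (fun i => (v i).re) (by linarith [hnn fun i => (v i).re, hnn fun i => (v i).im])
  have him := hz (fun i => (v i).im) (by linarith [hnn fun i => (v i).re, hnn fun i => (v i).im])
  exact hv (funext fun i => Complex.ext (congrFun hre i) (congrFun him i))

end MatrixCalculus

/-! ### Wirtinger derivatives -/

section Wirtinger

variable {n : Type*}

/-- `F` is real differentiable at `Z` along `H` and along `i H`, and its holomorphic derivative along `H` is `a`. The
antiholomorphic derivative `b` is existentially quantified, as only `a` enters the operators `∂^{αβ}`. -/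
def HasWirtinger (F : Matrix n n ℂ → ℂ) (Z H : Matrix n n ℂ) (a : ℂ) : Prop :=
  ∃ b, HasDerivAt (fun t : ℝ => F (Z + t • H)) (a + b) 0 ∧
    HasDerivAt (fun t : ℝ => F (Z + t • (Complex.I • H))) (Complex.I * (a - b)) 0

namespace HasWirtinger

variable {F G : Matrix n n ℂ → ℂ} {Z H : Matrix n n ℂ} {a a' : ℂ}

theorem const (c : ℂ) : HasWirtinger (fun _ => c) Z H 0 :=
  ⟨0, by simpa using hasDerivAt_const (0 : ℝ) c, by simpa using hasDerivAt_const (0 : ℝ) c⟩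

theorem add (h : HasWirtinger F Z H a) (h' : HasWirtinger G Z H a') :
    HasWirtinger (fun Z => F Z + G Z) Z H (a + a') := by
  obtain ⟨b, h1, h2⟩ := h
  obtain ⟨b', h1', h2'⟩ := h'
  exact ⟨b + b', (h1.add h1').congr_deriv (by ring), (h2.add h2').congr_deriv (by ring)⟩

theorem mul (h : HasWirtinger F Z H a) (h' : HasWirtinger G Z H a') :
    HasWirtinger (fun Z => F Z * G Z) Z H (a * G Z + F Z * a') := by
  obtain ⟨b, h1, h2⟩ := h
  obtain ⟨b', h1', h2'⟩ := h'
  refine ⟨b * G Z + F Z * b', ?_, ?_⟩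
  · exact (h1.mul h1').congr_deriv (by simp only [zero_smul, add_zero]; ring)
  · exact (h2.mul h2').congr_deriv (by simp only [zero_smul, add_zero]; ring)

theorem const_mul (c : ℂ) (h : HasWirtinger F Z H a) : HasWirtinger (fun Z => c * F Z) Z H (c * a) := by
  have := (const c).mul h
  rwa [zero_mul, zero_add] at this

theorem sum {κ : Type*} (t : Finset κ) {F : κ → Matrix n n ℂ → ℂ} {a : κ → ℂ}
    (h : ∀ i ∈ t, HasWirtinger (F i) Z H (a i)) : HasWirtinger (fun Z => ∑ i ∈ t, F i Z) Z H (∑ i ∈ t, a i) := by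
  classical
  induction t using Finset.induction_on with
  | empty => simpa using const 0
  | insert i t hi ih =>
    simp only [Finset.sum_insert hi]
    exact (h i (Finset.mem_insert_self i t)).add (ih fun j hj => h j (Finset.mem_insert_of_mem hj))

/-- Here `L K` is the derivative along `K`; the derivative along `i H` being `i L H`, the antiholomorphic part is zero. -/
theorem of_holomorphic {L : Matrix n n ℂ → ℂ} (hL : L (Complex.I • H) = Complex.I * L H)
    (h : ∀ K, HasDerivAt (fun t : ℝ => F (Z + t • K)) (L K) 0) : HasWirtinger F Z H (L H) :=
  ⟨0, by simpa using h H, by simpa [hL] using h (Complex.I • H)⟩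

theorem wirtinger_eq [DecidableEq n] {μ ν : n} (h : HasWirtinger F Z (coordDir μ ν) a) : wirtinger μ ν F Z = a := by
  obtain ⟨b, h1, h2⟩ := h
  rw [wirtinger, lineDeriv, lineDeriv, h1.deriv, h2.deriv]
  linear_combination (-(1 / 2) * (a - b)) * Complex.I_mul_I

/-- The derivatives along symmetric directions depend only on the values on the Siegel upper half space, which is open in the
symmetric matrices but not in all matrices. -/
theorem congr [Fintype n] (hZ : Z ∈ siegelUpperHalfSpace n) (hH : H.IsSymm)
    (hFG : ∀ Z ∈ siegelUpperHalfSpace n, F Z = G Z) (h : HasWirtinger F Z H a) : HasWirtinger G Z H a := by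
  classical
  obtain ⟨b, h1, h2⟩ := h
  refine ⟨b, h1.congr_of_eventuallyEq ?_, h2.congr_of_eventuallyEq ?_⟩
  · filter_upwards [eventually_mem_siegelUpperHalfSpace hZ hH] with t ht using (hFG _ ht).symm
  · filter_upwards [eventually_mem_siegelUpperHalfSpace hZ (hH.smul Complex.I)] with t ht using (hFG _ ht).symm

end HasWirtinger

variable [DecidableEq n]

theorem coordDir_isSymm (μ ν : n) : (coordDir μ ν).IsSymm := by
  ext i j
  simp only [coordDir, Matrix.transpose_apply, Matrix.of_apply, Sym2.eq_swap (a := i)]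

theorem diffLink_eq [Fintype n] {ι : Type*} (e : ι → n → ℂ) {F : Matrix n n ℂ → ℂ} {Z : Matrix n n ℂ} {a : n → n → ℂ}
    (h : ∀ μ ν, HasWirtinger F Z (coordDir μ ν) (a μ ν)) (α β : ι) :
    diffLink e s(α, β) F Z = ∑ μ, ∑ ν, e α μ * e β ν * ((1 + if μ = ν then 1 else 0) / 2 * a μ ν) := by
  simp only [diffLink, Sym2.lift_mk, diffEntry, (h _ _).wirtinger_eq]

/-- The coefficients `(1 + δ_{μν}) / 2` of the matrix `∂` count each symmetric pair of coordinates once. -/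
theorem sum_coordDir [Fintype n] (x y : n → ℂ) :
    ∑ μ, ∑ ν, (x μ * y ν * ((1 + if μ = ν then 1 else 0) / 2)) • coordDir μ ν =
      (1 / 2 : ℂ) • (Matrix.vecMulVec x y + Matrix.vecMulVec y x) := by
  ext i j
  have h : ∀ μ ν, (x μ * y ν * ((1 + if μ = ν then 1 else 0) / 2)) * coordDir μ ν i j =
      (1 / 2) * ((if i = μ then x μ else 0) * (if j = ν then y ν else 0)) +
        (1 / 2) * ((if i = ν then y ν else 0) * (if j = μ then x μ else 0)) := fun μ ν => by
    simp only [coordDir, Matrix.of_apply, Sym2.eq_iff]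
    by_cases h1 : μ = ν
    · subst h1
      by_cases h2 : i = μ <;> by_cases h3 : j = μ <;> simp [h2, h3]
      ring
    · by_cases h2 : i = μ
      · subst h2
        by_cases h3 : j = ν <;> simp [h1, h3]
        ring
      · by_cases h3 : i = ν <;> by_cases h4 : j = μ <;> simp [h1, h2, h3, h4, Ne.symm h1]
        ring
  simp only [Matrix.sum_apply, Matrix.smul_apply, smul_eq_mul, h, Finset.sum_add_distrib, ← Finset.mul_sum,
    Matrix.add_apply, Matrix.vecMulVec_apply]
  simp
  ring

end Wirtinger

/-! ### Derivatives of `Δ`, `E` and the weight function -/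

section Derivatives

variable {n : Type*} [Fintype n] [DecidableEq n]

theorem hasDerivAt_ofReal_cpow {r : ℝ → ℝ} {r' x : ℝ} (hr : HasDerivAt r r' x) (hpos : 0 < r x) (s : ℂ) :
    HasDerivAt (fun t => ((r t : ℝ) : ℂ) ^ s) (((r x : ℝ) : ℂ) ^ s * (s * (r' / r x : ℝ))) x := by
  have h1 := hr.ofReal_comp
  have h2 : HasDerivAt (fun z : ℂ => z ^ s) (s * ((r x : ℝ) : ℂ) ^ (s - 1)) ((r x : ℝ) : ℂ) := by
    have := (hasDerivAt_id ((r x : ℝ) : ℂ)).cpow_const (c := s) (Complex.ofReal_mem_slitPlane.mpr hpos)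
    simpa using! this
  have hne : ((r x : ℝ) : ℂ) ≠ 0 := Complex.ofReal_ne_zero.mpr hpos.ne'
  refine (HasDerivAt.comp (h := fun t => ((r t : ℝ) : ℂ)) x h2 h1).congr_deriv ?_
  rw [Complex.cpow_sub _ _ hne, Complex.cpow_one]
  push_cast
  field_simp

theorem autoFactor_add_smul (g : Matrix (n ⊕ n) (n ⊕ n) ℝ) (Z K : Matrix n n ℂ) (t : ℝ) :
    autoFactor g (Z + t • K) = autoFactor g Z + (t : ℂ) • (g.toBlocks₂₁.map Complex.ofReal * K) := by
  have h : t • K = (t : ℂ) • K := by ext i j; simp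
  rw [autoFactor, autoFactor, h, mul_add, mul_smul_comm]
  abel

variable {g : Matrix (n ⊕ n) (n ⊕ n) ℝ} (hg : g ∈ Matrix.symplecticGroup n ℝ)
  {Z : Matrix n n ℂ} (hZ : Z ∈ siegelUpperHalfSpace n)
include hZ

theorem isUnit_det_im : IsUnit (Z.map Complex.im).det :=
  (Matrix.isUnit_iff_isUnit_det _).mp hZ.2.isUnit

theorem smallEps_pos : 0 < smallEps Z := by
  have := hZ.2.det_pos
  simpa [smallEps] using this

/-- As `Im` is real linear, the real derivative of `E` sees `K` and its conjugate: `2i Im K = K - K̄`. -/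
theorem hasDerivAt_bigE (K : Matrix n n ℂ) (i j : n) :
    HasDerivAt (fun t : ℝ => bigE (Z + t • K) i j) (-(bigE Z * (K - K.map (starRingEnd ℂ)) * bigE Z) i j) 0 := by
  have h1 := (hasDerivAt_inv_add_smul (Z.map Complex.im) (K.map Complex.im) (isUnit_det_im hZ) i j).ofReal_comp.const_mul
    (1 / (2 * Complex.I))
  have h2 : bigE Z * (K - K.map (starRingEnd ℂ)) * bigE Z =
      (1 / (2 * Complex.I)) • ((Z.map Complex.im)⁻¹ * K.map Complex.im * (Z.map Complex.im)⁻¹).map Complex.ofRealHom := by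
    have h3 : K - K.map (starRingEnd ℂ) = (2 * Complex.I) • (K.map Complex.im).map Complex.ofRealHom := by
      ext i j
      apply Complex.ext <;> simp
      ring
    have h4 : bigE Z = (1 / (2 * Complex.I)) • ((Z.map Complex.im)⁻¹).map Complex.ofRealHom := rfl
    rw [h3, h4, Matrix.map_mul, Matrix.map_mul]
    simp only [Matrix.smul_mul, Matrix.mul_smul, smul_smul]
    congr 1
    field_simp
  simp only [bigE, map_im_add_smul, Matrix.smul_apply, smul_eq_mul, Matrix.map_apply]
  refine h1.congr_deriv ?_
  change _ = -((bigE Z * (K - K.map (starRingEnd ℂ)) * bigE Z) i j)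
  rw [h2, Matrix.smul_apply, Matrix.map_apply, smul_eq_mul, Complex.ofReal_neg, mul_neg]
  rfl

theorem hasWirtinger_bigE (H : Matrix n n ℂ) (i j : n) :
    HasWirtinger (fun Z => bigE Z i j) Z H (-(bigE Z * H * bigE Z) i j) := by
  refine ⟨(bigE Z * H.map (starRingEnd ℂ) * bigE Z) i j, (hasDerivAt_bigE hZ H i j).congr_deriv ?_,
    (hasDerivAt_bigE hZ (Complex.I • H) i j).congr_deriv ?_⟩
  · rw [Matrix.mul_sub, Matrix.sub_mul, Matrix.sub_apply]; ring
  · have h : (Complex.I • H).map (starRingEnd ℂ) = -Complex.I • H.map (starRingEnd ℂ) := by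
      ext i j; simp
    rw [h, Matrix.mul_sub, Matrix.sub_mul, Matrix.sub_apply, Matrix.mul_smul, Matrix.smul_mul, Matrix.mul_smul,
      Matrix.smul_mul, Matrix.smul_apply, Matrix.smul_apply, smul_eq_mul, smul_eq_mul]
    ring

theorem hasDerivAt_smallEps (K : Matrix n n ℂ) :
    HasDerivAt (fun t : ℝ => smallEps (Z + t • K))
      (smallEps Z * ((Z.map Complex.im)⁻¹ * K.map Complex.im).trace) 0 := by
  have h := hasDerivAt_det_add_smul (Z.map Complex.im) (K.map Complex.im) (isUnit_det_im hZ)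
  simpa only [smallEps, map_im_add_smul] using h

theorem hasWirtinger_smallEps_cpow (s : ℂ) (H : Matrix n n ℂ) :
    HasWirtinger (fun Z => ((smallEps Z : ℝ) : ℂ) ^ s) Z H
      (((smallEps Z : ℝ) : ℂ) ^ s * (s * (bigE Z * H).trace)) := by
  have hpos := smallEps_pos hZ
  have key : ∀ K : Matrix n n ℂ, HasDerivAt (fun t : ℝ => ((smallEps (Z + t • K) : ℝ) : ℂ) ^ s)
      (((smallEps Z : ℝ) : ℂ) ^ s * (s * (bigE Z * (K - K.map (starRingEnd ℂ))).trace)) 0 := fun K => by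
    have h4 : (bigE Z * (K - K.map (starRingEnd ℂ))).trace =
        ((((Z.map Complex.im)⁻¹ * K.map Complex.im).trace : ℝ) : ℂ) := by
      have h3 : K - K.map (starRingEnd ℂ) = (2 * Complex.I) • (K.map Complex.im).map Complex.ofRealHom := by
        ext i j
        apply Complex.ext <;> simp
        ring
      have h4 : bigE Z = (1 / (2 * Complex.I)) • ((Z.map Complex.im)⁻¹).map Complex.ofRealHom := rfl
      rw [h3, h4, Matrix.smul_mul, Matrix.mul_smul, smul_smul, ← Matrix.map_mul]
      rw [show (1 / (2 * Complex.I) * (2 * Complex.I)) = 1 by field_simp, one_smul]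
      simp only [Matrix.trace, Matrix.diag_apply, Matrix.map_apply, Complex.ofReal_sum]
      rfl
    refine (hasDerivAt_ofReal_cpow (hasDerivAt_smallEps hZ K) (by rwa [zero_smul, add_zero]) s).congr_deriv ?_
    rw [zero_smul, add_zero, h4, mul_div_cancel_left₀ _ hpos.ne']
  refine ⟨-(((smallEps Z : ℝ) : ℂ) ^ s * (s * (bigE Z * H.map (starRingEnd ℂ)).trace)), (key H).congr_deriv ?_,
    (key (Complex.I • H)).congr_deriv ?_⟩
  · rw [Matrix.mul_sub, Matrix.trace_sub]; ring
  · have h : (Complex.I • H).map (starRingEnd ℂ) = -Complex.I • H.map (starRingEnd ℂ) := by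
      ext i j; simp
    rw [h, Matrix.mul_sub, Matrix.trace_sub, Matrix.mul_smul, Matrix.mul_smul, Matrix.trace_smul, Matrix.trace_smul,
      smul_eq_mul, smul_eq_mul]
    ring

include hg

theorem hasDerivAt_bigDelta (K : Matrix n n ℂ) (i j : n) :
    HasDerivAt (fun t : ℝ => bigDelta g (Z + t • K) i j) (-(bigDelta g Z * K * bigDelta g Z) i j) 0 := by
  simp only [bigDelta, autoFactor_add_smul, Matrix.mul_apply (M := (_ + _)⁻¹)]
  have h1 : ∀ k, HasDerivAt (fun t : ℝ => (autoFactor g Z + (t : ℂ) • (g.toBlocks₂₁.map Complex.ofReal * K))⁻¹ i k)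
      (-((autoFactor g Z)⁻¹ * (g.toBlocks₂₁.map Complex.ofReal * K) * (autoFactor g Z)⁻¹) i k) 0 := fun k =>
    HasDerivAt.comp_ofReal (z := 0) (by
      simpa using hasDerivAt_inv_add_smul (autoFactor g Z) (g.toBlocks₂₁.map Complex.ofReal * K)
        (isUnit_det_autoFactor hg hZ) i k)
  refine (HasDerivAt.fun_sum fun k _ => (h1 k).mul_const (g.toBlocks₂₁.map Complex.ofReal k j)).congr_deriv ?_
  simp only [neg_mul, Finset.sum_neg_distrib, ← Matrix.mul_apply, Matrix.mul_assoc]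

theorem hasWirtinger_bigDelta (H : Matrix n n ℂ) (i j : n) :
    HasWirtinger (fun Z => bigDelta g Z i j) Z H (-(bigDelta g Z * H * bigDelta g Z) i j) :=
  HasWirtinger.of_holomorphic (L := fun H => -(bigDelta g Z * H * bigDelta g Z) i j)
    (by simp) fun K => hasDerivAt_bigDelta hg hZ K i j

theorem hasDerivAt_smallDelta (K : Matrix n n ℂ) :
    HasDerivAt (fun t : ℝ => smallDelta g (Z + t • K)) (smallDelta g Z * (bigDelta g Z * K).trace) 0 := by
  simp only [smallDelta, autoFactor_add_smul]
  refine HasDerivAt.comp_ofReal (z := 0) (e := fun z : ℂ =>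
    (autoFactor g Z + z • (g.toBlocks₂₁.map Complex.ofReal * K)).det) ?_
  rw [bigDelta, Matrix.mul_assoc]
  simpa using hasDerivAt_det_add_smul (autoFactor g Z) (g.toBlocks₂₁.map Complex.ofReal * K)
        (isUnit_det_autoFactor hg hZ)

theorem smallDelta_ne_zero : smallDelta g Z ≠ 0 := (isUnit_det_autoFactor hg hZ).ne_zero

theorem hasWirtinger_smallDelta_zpow (k : ℤ) (H : Matrix n n ℂ) :
    HasWirtinger (fun Z => smallDelta g Z ^ k) Z H (smallDelta g Z ^ k * (k * (bigDelta g Z * H).trace)) := by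
  refine HasWirtinger.of_holomorphic (L := fun H => smallDelta g Z ^ k * (k * (bigDelta g Z * H).trace))
    (by simp only [Matrix.mul_smul, Matrix.trace_smul, smul_eq_mul]; ring) fun K => ?_
  have hne := smallDelta_ne_zero hg hZ
  have h1 := hasDerivAt_smallDelta hg hZ K
  have h2 := (hasDerivAt_zpow k (smallDelta g (Z + (0 : ℝ) • K)) (Or.inl (by rwa [zero_smul, add_zero]))).comp
    (0 : ℝ) h1
  refine h2.congr_deriv ?_
  rw [zero_smul, add_zero, zpow_sub_one₀ hne]
  field_simp

theorem hasWirtinger_norm_smallDelta_cpow (s : ℂ) (H : Matrix n n ℂ) :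
    HasWirtinger (fun Z => ((‖smallDelta g Z‖ : ℝ) : ℂ) ^ (-2 * s)) Z H
      (((‖smallDelta g Z‖ : ℝ) : ℂ) ^ (-2 * s) * (-s * (bigDelta g Z * H).trace)) := by
  have hne := smallDelta_ne_zero hg hZ
  have hpos : 0 < ‖smallDelta g Z‖ := norm_pos_iff.mpr hne
  have key : ∀ K : Matrix n n ℂ, HasDerivAt (fun t : ℝ => ((‖smallDelta g (Z + t • K)‖ : ℝ) : ℂ) ^ (-2 * s))
      (((‖smallDelta g Z‖ : ℝ) : ℂ) ^ (-2 * s) * (-2 * s * ((bigDelta g Z * K).trace.re : ℂ))) 0 := fun K => by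
    have h0 : HasDerivAt (fun t : ℝ => ‖smallDelta g (Z + t • K)‖)
        (‖smallDelta g Z‖ * (bigDelta g Z * K).trace.re) 0 := by
      have h1 := (hasDerivAt_smallDelta hg hZ K).norm_sq.sqrt (by
        rw [zero_smul, add_zero]; exact pow_ne_zero 2 hpos.ne')
      simp only [Real.sqrt_sq (norm_nonneg _)] at h1
      refine h1.congr_deriv ?_
      have h2 : (smallDelta g Z * (bigDelta g Z * K).trace * starRingEnd ℂ (smallDelta g Z)) =
          ((‖smallDelta g Z‖ ^ 2 : ℝ) : ℂ) * (bigDelta g Z * K).trace := by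
        rw [mul_right_comm, Complex.mul_conj, Complex.normSq_eq_norm_sq]
      rw [zero_smul, add_zero, Complex.inner, h2, Complex.re_ofReal_mul]
      field_simp
    refine (hasDerivAt_ofReal_cpow h0 (by rwa [zero_smul, add_zero]) (-2 * s)).congr_deriv ?_
    rw [zero_smul, add_zero, mul_div_cancel_left₀ _ hpos.ne']
  have hre : ∀ z : ℂ, ((z.re : ℝ) : ℂ) = (z + starRingEnd ℂ z) / 2 := fun z => by
    rw [Complex.add_conj]; push_cast; ring
  refine ⟨((‖smallDelta g Z‖ : ℝ) : ℂ) ^ (-2 * s) * (-s * starRingEnd ℂ (bigDelta g Z * H).trace),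
    (key H).congr_deriv ?_, (key (Complex.I • H)).congr_deriv ?_⟩
  · rw [hre]; ring
  · rw [hre, Matrix.mul_smul, Matrix.trace_smul, smul_eq_mul, map_mul, Complex.conj_I]; ring

/-- The logarithmic derivative is `-(k + s) tr (Δ H) + s tr (E H)`: of `|δ|^{-2s}` only the holomorphic factor `δ^{-s}`
counts. -/
theorem hasWirtinger_weightFun (k : ℤ) (s : ℂ) (H : Matrix n n ℂ) :
    HasWirtinger (weightFun k s g) Z H
      (weightFun k s g Z * (-(k + s) * (bigDelta g Z * H).trace + s * (bigE Z * H).trace)) := by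
  have h := ((hasWirtinger_smallDelta_zpow hg hZ (-k) H).mul (hasWirtinger_norm_smallDelta_cpow hg hZ s H)).mul
    (hasWirtinger_smallEps_cpow hZ s H)
  obtain ⟨b, h1, h2⟩ := h
  have e : ∀ a a' : ℂ, a = a' → a + b = a' + b ∧ Complex.I * (a - b) = Complex.I * (a' - b) := by
    rintro a _ rfl; exact ⟨rfl, rfl⟩
  refine ⟨b, h1.congr_deriv (e _ _ ?_).1, h2.congr_deriv (e _ _ ?_).2⟩ <;>
  · simp only [weightFun]; push_cast; ring

end Derivatives

/-! ### The operators `∂^{αβ}` -/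

section LinkForm

variable {ι n : Type*} [Fintype n]

/-- The linear functional `A ↦ (e^{(α)} A ᵗe^{(β)} + e^{(β)} A ᵗe^{(α)}) / 2` on all matrices, which extends the
substitution `A ↦ A^{αβ}` from the symmetric ones. -/
def linkForm (e : ι → n → ℂ) : Sym2 ι → Matrix n n ℂ →ₗ[ℂ] ℂ :=
  Sym2.lift ⟨fun α β =>
    { toFun := fun A => (1 / 2) * (e α ⬝ᵥ A *ᵥ e β + e β ⬝ᵥ A *ᵥ e α)
      map_add' := fun A A' => by simp only [Matrix.add_mulVec, dotProduct_add]; ring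
      map_smul' := fun c A => by
        simp only [Matrix.smul_mulVec, dotProduct_smul, smul_eq_mul, RingHom.id_apply]; ring },
    fun α β => by
      ext1 A
      exact congrArg (fun z : ℂ => (1 / 2) * z) (add_comm (e α ⬝ᵥ A *ᵥ e β) (e β ⬝ᵥ A *ᵥ e α))⟩

theorem linkForm_mk (e : ι → n → ℂ) (α β : ι) (A : Matrix n n ℂ) :
    linkForm e s(α, β) A = (1 / 2) * (e α ⬝ᵥ A *ᵥ e β + e β ⬝ᵥ A *ᵥ e α) := rfl

theorem dotProduct_mulVec_comm_of_isSymm {A : Matrix n n ℂ} (hA : A.IsSymm) (x y : n → ℂ) :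
    x ⬝ᵥ A *ᵥ y = y ⬝ᵥ A *ᵥ x := by
  rw [Matrix.dotProduct_mulVec, ← Matrix.mulVec_transpose, hA.eq, dotProduct_comm]

theorem linkForm_of_isSymm (e : ι → n → ℂ) {A : Matrix n n ℂ} (hA : A.IsSymm) (α β : ι) :
    linkForm e s(α, β) A = e α ⬝ᵥ A *ᵥ e β := by
  rw [linkForm_mk, dotProduct_mulVec_comm_of_isSymm hA (e β)]; ring

theorem linkValue_eq_linkForm [DecidableEq n] (e : ι → n → ℂ) {A : Matrix n n ℂ} (hA : A.IsSymm) (u : Sym2 ι) :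
    linkValue hA e u = linkForm e u A := by
  induction u with | _ α β => exact (linkForm_of_isSymm e hA α β).symm

/-- The direction in the space of symmetric matrices along which `∂^{αβ}` differentiates. -/
def linkDir (e : ι → n → ℂ) (α β : ι) : Matrix n n ℂ :=
  (1 / 2 : ℂ) • (Matrix.vecMulVec (e α) (e β) + Matrix.vecMulVec (e β) (e α))

theorem trace_mul_linkDir (e : ι → n → ℂ) (α β : ι) (A : Matrix n n ℂ) :
    (A * linkDir e α β).trace = linkForm e s(α, β) A := by
  simp only [linkDir, linkForm_mk, Matrix.mul_smul, Matrix.trace_smul, Matrix.mul_add, Matrix.trace_add,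
    Matrix.mul_vecMulVec, Matrix.trace_vecMulVec, smul_eq_mul, dotProduct_comm (A *ᵥ _)]
  ring

/-- By the Riccati equations for `Δ` and `E`, this is the reason why `∂^{αβ}` changes a covariance into its
`wickProduct`. -/
theorem linkForm_mul_linkDir_mul (e : ι → n → ℂ) {A : Matrix n n ℂ} (hA : A.IsSymm) (α β γ δ : ι) :
    linkForm e s(γ, δ) (A * linkDir e α β * A) =
      (1 / 2) * (linkForm e s(α, γ) A * linkForm e s(β, δ) A + linkForm e s(α, δ) A * linkForm e s(β, γ) A) := by
  have h : ∀ x y z w : n → ℂ, x ⬝ᵥ (A * Matrix.vecMulVec z w * A) *ᵥ y = (z ⬝ᵥ A *ᵥ x) * (w ⬝ᵥ A *ᵥ y) :=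
    fun x y z w => by
      rw [← Matrix.mulVec_mulVec, ← Matrix.mulVec_mulVec, Matrix.vecMulVec_mulVec, Matrix.mulVec_smul,
        dotProduct_smul, dotProduct_mulVec_comm_of_isSymm hA x z]
      simp
  simp only [linkForm_of_isSymm e hA]
  rw [linkForm_mk]
  simp only [linkDir, Matrix.mul_smul, Matrix.smul_mul, Matrix.mul_add, Matrix.add_mul, Matrix.smul_mulVec,
    dotProduct_smul, Matrix.add_mulVec, dotProduct_add, h, smul_eq_mul]
  ring

theorem diffLink_of_isLinearMap [DecidableEq n] (e : ι → n → ℂ) {F : Matrix n n ℂ → ℂ} {Z : Matrix n n ℂ}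
    {a : Matrix n n ℂ → ℂ} (ha : IsLinearMap ℂ a) (h : ∀ μ ν, HasWirtinger F Z (coordDir μ ν) (a (coordDir μ ν)))
    (α β : ι) : diffLink e s(α, β) F Z = a (linkDir e α β) := by
  rw [diffLink_eq e h, linkDir, ← sum_coordDir]
  change _ = ha.mk' a _
  simp only [map_sum, map_smul, smul_eq_mul, IsLinearMap.mk'_apply, mul_assoc]

theorem HasWirtinger.linearMap [DecidableEq n] {A : Matrix n n ℂ → Matrix n n ℂ} {Z H A' : Matrix n n ℂ}
    (h : ∀ i j, HasWirtinger (fun Z => A Z i j) Z H (A' i j)) (L : Matrix n n ℂ →ₗ[ℂ] ℂ) :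
    HasWirtinger (fun Z => L (A Z)) Z H (L A') := by
  have hL : ∀ B : Matrix n n ℂ, L B = ∑ i, ∑ j, L (Matrix.single i j 1) * B i j := fun B => by
    conv_lhs => rw [Matrix.matrix_eq_sum_single B]
    simp only [map_sum]
    refine Finset.sum_congr rfl fun i _ => Finset.sum_congr rfl fun j _ => ?_
    rw [mul_comm, ← smul_eq_mul, ← map_smul, Matrix.smul_single, smul_eq_mul, mul_one]
  rw [funext fun Z => hL (A Z), hL A']
  exact HasWirtinger.sum _ fun i _ => HasWirtinger.sum _ fun j _ => (h i j).const_mul _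

end LinkForm

/-! ### Derivatives of moments -/

section HeatDerivative

variable {K ι n : Type*} [DecidableEq K] [DecidableEq ι] [Fintype K] [Fintype ι]

/-- A polynomial-valued function of `Z` has the holomorphic derivative `m'` along `H`, tested on all linear
functionals. -/
def HasPolyWirtinger {σ : Type*} (m : Matrix n n ℂ → MvPolynomial σ ℂ) (Z H : Matrix n n ℂ)
    (m' : MvPolynomial σ ℂ) : Prop :=
  ∀ L : MvPolynomial σ ℂ →ₗ[ℂ] ℂ, HasWirtinger (fun Z => L (m Z)) Z H (L m')

theorem HasPolyWirtinger.heat {d : K → ℂ} {D : Matrix n n ℂ → K → Sym2 ι → ℂ} {D' : K → Sym2 ι → ℂ}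
    {Z H : Matrix n n ℂ} (hD : ∀ c u, HasWirtinger (fun Z => D Z c u) Z H (D' c u))
    {m : Matrix n n ℂ → MvPolynomial (K × Sym2 ι) ℂ} {m' : MvPolynomial (K × Sym2 ι) ℂ}
    (hm : HasPolyWirtinger m Z H m') :
    HasPolyWirtinger (fun Z => heat d (D Z) (m Z)) Z H (heat d D' (m Z) + heat d (D Z) m') := fun L => by
  simp only [heat_apply, map_add, map_sum, map_smul, smul_eq_mul, ← Finset.sum_add_distrib]
  exact HasWirtinger.sum _ fun c _ => HasWirtinger.sum _ fun γ _ => HasWirtinger.sum _ fun δ _ =>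
    (hD c s(γ, δ)).mul (hm (L ∘ₗ contraction (d c) (linkMul ℂ c) (linkDeriv ℂ c) γ δ))

theorem HasPolyWirtinger.heat_pow (d : K → ℂ) {D : Matrix n n ℂ → K → Sym2 ι → ℂ} {D' : K → Sym2 ι → ℂ}
    {Z H : Matrix n n ℂ} (hD : ∀ c u, HasWirtinger (fun Z => D Z c u) Z H (D' c u))
    (m : MvPolynomial (K × Sym2 ι) ℂ) (r : ℕ) :
    HasPolyWirtinger (fun Z => (SiegelPullback.heat d (D Z) ^ r) m) Z H
      (r • SiegelPullback.heat d D' ((SiegelPullback.heat d (D Z) ^ (r - 1)) m)) := by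
  induction r with
  | zero =>
    intro L
    simpa using HasWirtinger.const (L m)
  | succ r ih =>
    have h := HasPolyWirtinger.heat (d := d) hD ih
    simp only [pow_succ', Module.End.mul_apply]
    convert h using 1
    have hc : SiegelPullback.heat d (D Z) * SiegelPullback.heat d D' =
        SiegelPullback.heat d D' * SiegelPullback.heat d (D Z) := by
      have := heat_comm d (D Z) D'
      rwa [Ring.lie_def, sub_eq_zero] at this
    rcases r with _ | r
    · simp
    · have h1 := congrArg (fun T => T ((SiegelPullback.heat d (D Z) ^ r) m)) hc
      simp only [Module.End.mul_apply] at h1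
      rw [map_nsmul, Nat.add_sub_cancel, Nat.add_sub_cancel, h1, pow_succ' _ r, Module.End.mul_apply, succ_nsmul']

theorem hasWirtinger_expectation (d : K → ℂ) {D : Matrix n n ℂ → K → Sym2 ι → ℂ} {D' : K → Sym2 ι → ℂ}
    {Z H : Matrix n n ℂ} (hD : ∀ c u, HasWirtinger (fun Z => D Z c u) Z H (D' c u))
    (m : MvPolynomial (K × Sym2 ι) ℂ) (r : ℕ) :
    HasWirtinger (fun Z => expectation d (D Z) r m) Z H
      (r * MvPolynomial.constantCoeff (heat d D' ((heat d (D Z) ^ (r - 1)) m))) := by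
  have h := HasPolyWirtinger.heat_pow d hD m r (MvPolynomial.lcoeff ℂ 0)
  rw [map_nsmul, nsmul_eq_mul] at h
  exact h

end HeatDerivative

/-! ### Iterated derivatives as moments -/

section LinkDerivatives

variable {K ι n : Type*} [DecidableEq K] [DecidableEq ι] [Fintype K] [Fintype ι] [Fintype n] [DecidableEq n]

/-- The covariance `-A_c^{αβ} / 2` of the Gaussian variables of colour `c`, for a family of symmetric matrices
`A_c`. -/
def covariance (e : ι → n → ℂ) (A : K → Matrix n n ℂ) (c : K) (u : Sym2 ι) : ℂ :=
  -(1 / 2) * linkForm e u (A c)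

/-- If the matrices `A_c` satisfy the Riccati equation `∂_H A_c = -A_c H A_c` and `f` satisfies
`∂_H log f = -½ ∑ d_c tr (A_c H)`, then iterated derivatives of `f` are `f` times moments. -/
theorem foldr_diffLink_eq (e : ι → n → ℂ) (d : K → ℂ) {A : K → Matrix n n ℂ → Matrix n n ℂ} {f : Matrix n n ℂ → ℂ}
    (hAs : ∀ Z ∈ siegelUpperHalfSpace n, ∀ c, (A c Z).IsSymm)
    (hA : ∀ Z ∈ siegelUpperHalfSpace n, ∀ c H i j,
      HasWirtinger (fun Z => A c Z i j) Z H (-(A c Z * H * A c Z) i j))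
    (hf : ∀ Z ∈ siegelUpperHalfSpace n, ∀ H,
      HasWirtinger f Z H (f Z * ∑ c, d c * (-(1 / 2) * (A c Z * H).trace)))
    (us : List (Sym2 ι)) {Z : Matrix n n ℂ} (hZ : Z ∈ siegelUpperHalfSpace n) :
    us.foldr (diffLink e) f Z = f Z * ((2 ^ us.length * (us.length).factorial : ℂ)⁻¹ *
      expectation d (covariance e fun c => A c Z) us.length (us.map fun u => colorSum K (MvPolynomial.X u)).prod) := by
  induction us generalizing Z with
  | nil => simp [expectation]
  | cons u us ih =>
    induction u with | _ α β =>
    set m := (us.map fun u => colorSum K (MvPolynomial.X u : MvPolynomial (Sym2 ι) ℂ)).prod with hm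
    set r := us.length with hr
    set D' : Matrix n n ℂ → K → Sym2 ι → ℂ := fun H c u => (1 / 2) * linkForm e u (A c Z * H * A c Z) with hD'
    have hD : ∀ H c u, HasWirtinger (fun Z => covariance e (fun c => A c Z) c u) Z H (D' H c u) := fun H c u => by
      have h := (HasWirtinger.linearMap (A' := -(A c Z * H * A c Z)) (hA Z hZ c H) (linkForm e u)).const_mul (-(1 / 2))
      rw [map_neg, neg_mul_neg] at h
      exact h
    set q := (heat d (covariance e fun c => A c Z) ^ (r - 1)) m with hq
    set κ : ℂ := (2 ^ r * r.factorial : ℂ)⁻¹ with hκ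
    set a : Matrix n n ℂ → ℂ := fun H =>
      (f Z * ∑ c, d c * (-(1 / 2) * (A c Z * H).trace)) * (κ * expectation d (covariance e fun c => A c Z) r m) +
        f Z * (κ * (r * MvPolynomial.constantCoeff (heat d (D' H) q))) with ha
    have hlin : IsLinearMap ℂ a := by
      constructor
      · intro H H'
        have h1 : D' (H + H') = D' H + D' H' := by
          funext c u
          simp only [hD', Pi.add_apply, Matrix.add_mul, map_add, mul_add]
        have h2 : ∑ c, d c * (-(1 / 2) * (A c Z * (H + H')).trace) =
            ∑ c, d c * (-(1 / 2) * (A c Z * H).trace) + ∑ c, d c * (-(1 / 2) * (A c Z * H').trace) := by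
          rw [← Finset.sum_add_distrib]
          refine Finset.sum_congr rfl fun c _ => ?_
          rw [Matrix.mul_add, Matrix.trace_add]
          ring
        simp only [ha, h1, h2, heat_add, LinearMap.add_apply, map_add]
        ring
      · intro t H
        have h1 : D' (t • H) = t • D' H := by
          funext c u
          simp only [hD', Pi.smul_apply, Matrix.mul_smul, Matrix.smul_mul, map_smul, smul_eq_mul]
          ring
        have h2 : ∑ c, d c * (-(1 / 2) * (A c Z * (t • H)).trace) = t * ∑ c, d c * (-(1 / 2) * (A c Z * H).trace) := by
          rw [Finset.mul_sum]
          refine Finset.sum_congr rfl fun c _ => ?_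
          rw [Matrix.mul_smul, Matrix.trace_smul, smul_eq_mul]
          ring
        simp only [ha, h1, h2, heat_smul, LinearMap.smul_apply, MvPolynomial.smul_eq_C_mul, map_mul,
          MvPolynomial.constantCoeff_C, smul_eq_mul]
        ring
    have hF : ∀ H : Matrix n n ℂ, H.IsSymm → HasWirtinger (us.foldr (diffLink e) f) Z H (a H) := fun H hH =>
      HasWirtinger.congr hZ hH (fun Z' hZ' => (ih hZ').symm)
        ((hf Z hZ H).mul ((hasWirtinger_expectation d (hD H) m r).const_mul κ))
    rw [List.foldr_cons, diffLink_of_isLinearMap e hlin (fun μ ν => hF _ (coordDir_isSymm μ ν)), List.map_cons,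
      List.prod_cons, List.length_cons, colorSum_X, expectation_succ_link]
    -- By the Riccati equation, the derivative of the covariance is its Wick product.
    have hW : D' (linkDir e α β) = wickProduct (covariance e fun c => A c Z) α β := by
      funext c u
      induction u with | _ γ δ =>
      simp only [hD', wickProduct, Sym2.lift_mk, linkForm_mul_linkDir_mul e (hAs Z hZ c), covariance]
      ring
    -- The normalization absorbs the factor `2 (r + 1)` of the moment recursion.
    have hκ' : (2 ^ (r + 1) * (r + 1).factorial : ℂ)⁻¹ * (2 * (r + 1)) = κ := by
      rw [hκ, Nat.factorial_succ]
      push_cast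
      have : (r : ℂ) + 1 ≠ 0 := by exact_mod_cast r.succ_ne_zero
      field_simp
      ring
    -- Both terms of the derivative now match the two terms of the moment recursion.
    simp only [ha, hW, trace_mul_linkDir]
    change f Z * (∑ c, d c * covariance e (fun c => A c Z) c s(α, β)) * _ + _ = _
    rw [← hκ']
    ring

theorem diffMonomial_eq (e : ι → n → ℂ) (d : K → ℂ) {A : K → Matrix n n ℂ → Matrix n n ℂ} {f : Matrix n n ℂ → ℂ}
    (hAs : ∀ Z ∈ siegelUpperHalfSpace n, ∀ c, (A c Z).IsSymm)
    (hA : ∀ Z ∈ siegelUpperHalfSpace n, ∀ c H i j,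
      HasWirtinger (fun Z => A c Z i j) Z H (-(A c Z * H * A c Z) i j))
    (hf : ∀ Z ∈ siegelUpperHalfSpace n, ∀ H,
      HasWirtinger f Z H (f Z * ∑ c, d c * (-(1 / 2) * (A c Z * H).trace)))
    (m : Sym2 ι →₀ ℕ) {Z : Matrix n n ℂ} (hZ : Z ∈ siegelUpperHalfSpace n) :
    diffMonomial e m f Z = f Z * ((2 ^ m.degree * (m.degree).factorial : ℂ)⁻¹ *
      expectation d (covariance e fun c => A c Z) m.degree (colorSum K (MvPolynomial.monomial m 1))) := by
  have h1 : (Finsupp.toMultiset m).toList.length = m.degree := by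
    rw [Multiset.length_toList, Finsupp.card_toMultiset, Finsupp.degree_apply]
    rfl
  have h2 : ((Finsupp.toMultiset m).toList.map fun u => colorSum K (MvPolynomial.X u)).prod =
      colorSum K (MvPolynomial.monomial m (1 : ℂ)) := by
    rw [← Multiset.prod_coe, ← Multiset.map_coe, Multiset.coe_toList, Finsupp.toMultiset_apply, Finsupp.sum,
      MvPolynomial.monomial_eq, map_one, one_mul, Finsupp.prod, map_prod, ← Multiset.coe_mapAddMonoidHom, map_sum,
      Multiset.prod_sum]
    refine Finset.prod_congr rfl fun u _ => ?_
    rw [map_nsmul, Multiset.prod_nsmul, map_pow]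
    simp
  rw [diffMonomial, foldr_diffLink_eq e d hAs hA hf _ hZ, h1, h2]

theorem polyDiff_eq {l : ℕ} (hι : Fintype.card ι = 2 * l) (e : ι → n → ℂ) (d : K → ℂ) {A : K → Matrix n n ℂ → Matrix n n ℂ} {f : Matrix n n ℂ → ℂ}
    (hAs : ∀ Z ∈ siegelUpperHalfSpace n, ∀ c, (A c Z).IsSymm)
    (hA : ∀ Z ∈ siegelUpperHalfSpace n, ∀ c H i j,
      HasWirtinger (fun Z => A c Z i j) Z H (-(A c Z * H * A c Z) i j))
    (hf : ∀ Z ∈ siegelUpperHalfSpace n, ∀ H,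
      HasWirtinger f Z H (f Z * ∑ c, d c * (-(1 / 2) * (A c Z * H).trace)))
    {P : MvPolynomial (Sym2 ι) ℂ} (hP : MvPolynomial.IsWeightedHomogeneous linkWeight P (1 : ι → ℤ))
    {Z : Matrix n n ℂ} (hZ : Z ∈ siegelUpperHalfSpace n) :
    polyDiff e P f Z = f Z * ((2 ^ l * l.factorial : ℂ)⁻¹ *
      expectation d (covariance e fun c => A c Z) l (colorSum K P)) := by
  conv_rhs => rw [P.as_sum]
  simp only [polyDiff, expectation, map_sum, Finset.mul_sum]
  refine Finset.sum_congr rfl fun m hm => ?_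
  have hdeg : m.degree = l := by
    have := degree_of_weight_eq_one (hP (MvPolynomial.mem_support_iff.mp hm))
    omega
  rw [diffMonomial_eq e d hAs hA hf m hZ, hdeg, expectation,
    show MvPolynomial.monomial m (P.coeff m) = P.coeff m • MvPolynomial.monomial m (1 : ℂ) by
      rw [MvPolynomial.smul_monomial, smul_eq_mul, mul_one], map_smul, map_smul, MvPolynomial.smul_eq_C_mul, map_mul,
    MvPolynomial.constantCoeff_C]
  ring

end LinkDerivatives

/-! ### Block diagonal points -/

section BlockDiagonal

variable {m n : Type*} [Fintype m] [Fintype n] [DecidableEq m] [DecidableEq n]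

theorem fromBlocks_mem_siegelUpperHalfSpace {Z : Matrix m m ℂ} {W : Matrix n n ℂ} (hZ : Z ∈ siegelUpperHalfSpace m)
    (hW : W ∈ siegelUpperHalfSpace n) : Matrix.fromBlocks Z 0 0 W ∈ siegelUpperHalfSpace (m ⊕ n) := by
  refine ⟨blockDiag_isSymm hZ.1 hW.1, ?_⟩
  have h : (Matrix.fromBlocks Z 0 0 W).map Complex.im =
      Matrix.fromBlocks (Z.map Complex.im) 0 0 (W.map Complex.im) := by
    ext i j
    rcases i with i | i <;> rcases j with j | j <;> simp
  rw [h]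
  refine Matrix.PosDef.of_dotProduct_mulVec_pos ?_ fun v hv => ?_
  · exact Matrix.IsHermitian.fromBlocks hZ.2.isHermitian (by simp) hW.2.isHermitian
  · obtain ⟨a, b, rfl⟩ : ∃ a b, v = Sum.elim a b := ⟨_, _, (Sum.elim_comp_inl_inr v).symm⟩
    have h2 : star (Sum.elim a b) ⬝ᵥ Matrix.fromBlocks (Z.map Complex.im) 0 0 (W.map Complex.im) *ᵥ Sum.elim a b =
        star a ⬝ᵥ Z.map Complex.im *ᵥ a + star b ⬝ᵥ W.map Complex.im *ᵥ b := by
      simp [Matrix.fromBlocks_mulVec, dotProduct, Fintype.sum_sum_type]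
    rw [h2]
    by_cases ha : a = 0
    · have hb : b ≠ 0 := by
        rintro rfl
        exact hv (by subst ha; ext i; rcases i with i | i <;> rfl)
      exact add_pos_of_nonneg_of_pos (hZ.2.posSemidef.dotProduct_mulVec_nonneg a) (hW.2.dotProduct_mulVec_pos hb)
    · exact add_pos_of_pos_of_nonneg (hZ.2.dotProduct_mulVec_pos ha) (hW.2.posSemidef.dotProduct_mulVec_nonneg b)

theorem bigE_fromBlocks {Z : Matrix m m ℂ} {W : Matrix n n ℂ} (hZ : Z ∈ siegelUpperHalfSpace m)
    (hW : W ∈ siegelUpperHalfSpace n) : bigE (Matrix.fromBlocks Z 0 0 W) = Matrix.fromBlocks (bigE Z) 0 0 (bigE W) := by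
  have h : (Matrix.fromBlocks Z 0 0 W).map Complex.im =
      Matrix.fromBlocks (Z.map Complex.im) 0 0 (W.map Complex.im) := by
    ext i j
    rcases i with i | i <;> rcases j with j | j <;> simp
  have h2 : (Matrix.fromBlocks (Z.map Complex.im) 0 0 (W.map Complex.im))⁻¹ =
      Matrix.fromBlocks (Z.map Complex.im)⁻¹ 0 0 (W.map Complex.im)⁻¹ := by
    refine Matrix.inv_eq_right_inv ?_
    rw [Matrix.fromBlocks_multiply, Matrix.mul_nonsing_inv _ (isUnit_det_im hZ),
      Matrix.mul_nonsing_inv _ (isUnit_det_im hW)]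
    simp
  rw [bigE, h, h2]
  ext i j
  rcases i with i | i <;> rcases j with j | j <;> simp [bigE]

theorem linkForm_fromBlocks_cross {l p q : ℕ} (x : Fin l → Fin p → ℂ) (y : Fin l → Fin q → ℂ)
    (A : Matrix (Fin p) (Fin p) ℂ) (B : Matrix (Fin q) (Fin q) ℂ) (a b : Fin l) :
    linkForm (blockVec x y) s(Sum.inl a, Sum.inr b) (Matrix.fromBlocks A 0 0 B) = 0 := by
  simp [linkForm_mk, blockVec, Matrix.fromBlocks_mulVec, dotProduct, Fintype.sum_sum_type]

end BlockDiagonal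

/-! ### The polynomial `𝔔` and the pullback formula -/

section Pullback

/-- The numbers of components `2k + 2s` and `-2s` of the two colours of Gaussian variables. -/
def dims {R : Type*} [CommRing R] (k : ℤ) (s : R) : Bool → R
  | true => 2 * k + 2 * s
  | false => -2 * s

theorem map_dims {R S : Type*} [CommRing R] [CommRing S] (φ : R →+* S) (k : ℤ) (s : R) (c : Bool) :
    φ (dims k s c) = dims k (φ s) c := by
  cases c <;> simp only [dims, map_add, map_mul, map_neg, map_ofNat, map_intCast]

/-- The matrices `Δ(g, Z)` and `E(Z)` that govern the two colours. -/
def colorMatrix {n : Type*} [Fintype n] [DecidableEq n] (g : Matrix (n ⊕ n) (n ⊕ n) ℝ) :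
    Bool → Matrix n n ℂ → Matrix n n ℂ
  | true => bigDelta g
  | false => bigE

/-- The covariance that is `-X^{αβ} / 2` in the first colour and zero in the second. -/
def universalCovariance (ι : Type*) : Bool → Sym2 ι → MvPolynomial (Sym2 ι) (Polynomial ℂ)
  | true, u => MvPolynomial.C (Polynomial.C (-(1 / 2))) * MvPolynomial.X u
  | false, _ => 0

/-- The polynomial `𝔔(X, s)`: the mean of `P(∑_κ y_{ακ} y_{βκ})` for Gaussian vectors `y` of formal dimension
`2k + 2s` and covariance `-X/2`. A second colour of dimension `-2s` and covariance zero is kept, so that the total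
dimension is `2k`. -/
def pullbackPolynomial {ι : Type*} [DecidableEq ι] [Fintype ι] (l : ℕ) (k : ℤ) (P : MvPolynomial (Sym2 ι) ℂ) :
    MvPolynomial (Sym2 ι) (Polynomial ℂ) :=
  MvPolynomial.C (Polynomial.C (2 ^ l * l.factorial : ℂ)⁻¹) *
    expectation (dims k (MvPolynomial.C Polynomial.X)) (universalCovariance ι) l
      (colorSum Bool (MvPolynomial.map (MvPolynomial.C.comp Polynomial.C) P))

theorem pullbackPolynomial_isWeightedHomogeneous {ι : Type*} [DecidableEq ι] [Fintype ι] (l : ℕ) (k : ℤ)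
    {P : MvPolynomial (Sym2 ι) ℂ} {w : ι → ℤ} (hP : MvPolynomial.IsWeightedHomogeneous linkWeight P w) :
    MvPolynomial.IsWeightedHomogeneous linkWeight (pullbackPolynomial l k P) w := by
  rw [← zero_add w]
  refine (MvPolynomial.isWeightedHomogeneous_C _ _).mul ?_
  refine IsJointlyHomogeneous.expectation ?_ ?_ (IsJointlyHomogeneous.colorSum_map _ hP) l
  · intro c
    rw [← map_dims]
    exact MvPolynomial.isWeightedHomogeneous_C _ _
  · rintro (_ | _) u
    · exact MvPolynomial.isWeightedHomogeneous_zero _ _ _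
    · rw [← zero_add (linkWeight u)]
      exact (MvPolynomial.isWeightedHomogeneous_C _ _).mul (MvPolynomial.isWeightedHomogeneous_X _ _ _)

theorem eval_pullbackPolynomial {ι : Type*} [DecidableEq ι] [Fintype ι] (l : ℕ) (k : ℤ) (P : MvPolynomial (Sym2 ι) ℂ)
    (s : ℂ) (v : Sym2 ι → ℂ) :
    MvPolynomial.eval v (MvPolynomial.map (Polynomial.evalRingHom s) (pullbackPolynomial l k P)) =
      (2 ^ l * l.factorial : ℂ)⁻¹ *
        expectation (dims k s) (fun c u => if c then -(1 / 2) * v u else 0) l (colorSum Bool P) := by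
  set φ : MvPolynomial (Sym2 ι) (Polynomial ℂ) →+* ℂ :=
    (MvPolynomial.eval v).comp (MvPolynomial.map (Polynomial.evalRingHom s)) with hφ
  have hC : ∀ f : Polynomial ℂ, φ (MvPolynomial.C f) = f.eval s := fun f => by simp [hφ]
  have hX : ∀ u, φ (MvPolynomial.X u) = v u := fun u => by simp [hφ]
  have h1 : (fun c => φ (dims k (MvPolynomial.C Polynomial.X) c)) = dims k s := by
    funext c
    rw [map_dims, hC, Polynomial.eval_X]
  have h2 : (fun c u => φ (universalCovariance ι c u)) = fun c u => if c then -(1 / 2) * v u else 0 := by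
    funext c u
    cases c <;> simp [universalCovariance, hC, hX]
  have h3 : MvPolynomial.map φ (MvPolynomial.map (MvPolynomial.C.comp Polynomial.C) P) = P := by
    have hid : φ.comp (MvPolynomial.C.comp Polynomial.C) = RingHom.id ℂ := RingHom.ext fun z => by
      change φ (MvPolynomial.C (Polynomial.C z)) = z
      rw [hC, Polynomial.eval_C]
    rw [MvPolynomial.map_map, hid, MvPolynomial.map_id]
  change φ (pullbackPolynomial l k P) = _
  rw [pullbackPolynomial, map_mul, hC, Polynomial.eval_C, map_expectation, map_colorSum, h1, h2, h3]

/-- The weight function is of the type treated in `polyDiff_eq`, with the two matrices `Δ` and `E` in dimensions `2k + 2s`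
and `-2s`. No harmonicity and no special point is needed here. -/
theorem polyDiff_weightFun {ι n : Type*} [DecidableEq ι] [Fintype ι] [DecidableEq n] [Fintype n] {l : ℕ}
    (hι : Fintype.card ι = 2 * l) (e : ι → n → ℂ) (k : ℤ) (s : ℂ) {g : Matrix (n ⊕ n) (n ⊕ n) ℝ}
    (hg : g ∈ Matrix.symplecticGroup n ℝ) {P : MvPolynomial (Sym2 ι) ℂ}
    (hP : MvPolynomial.IsWeightedHomogeneous linkWeight P (1 : ι → ℤ)) {Z : Matrix n n ℂ}
    (hZ : Z ∈ siegelUpperHalfSpace n) :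
    polyDiff e P (weightFun k s g) Z = weightFun k s g Z * ((2 ^ l * l.factorial : ℂ)⁻¹ *
      expectation (dims k s) (covariance e fun c => colorMatrix g c Z) l (colorSum Bool P)) := by
  refine polyDiff_eq hι e (dims k s) ?_ ?_ ?_ hP hZ
  · rintro Z hZ (_ | _)
    · exact bigE_isSymm hZ.1
    · exact bigDelta_isSymm hg hZ.1
  · rintro Z hZ (_ | _) H i j
    · exact hasWirtinger_bigE hZ H i j
    · exact hasWirtinger_bigDelta hg hZ H i j
  · intro Z hZ H
    have h := hasWirtinger_weightFun hg hZ k s H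
    convert h using 2
    simp only [Fintype.sum_bool, dims, colorMatrix]
    ring

theorem polyDiff_weightFun_fromBlocks {l p q : ℕ} (k : ℤ) (s : ℂ)
    {g : Matrix ((Fin p ⊕ Fin q) ⊕ (Fin p ⊕ Fin q)) ((Fin p ⊕ Fin q) ⊕ (Fin p ⊕ Fin q)) ℝ}
    (hg : g ∈ Matrix.symplecticGroup (Fin p ⊕ Fin q) ℝ) {P : MvPolynomial (Sym2 (Fin l ⊕ Fin l)) ℂ}
    (hP : MvPolynomial.IsWeightedHomogeneous linkWeight P (1 : Fin l ⊕ Fin l → ℤ))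
    (hharm : IsPluriharmonic (2 * (k : ℂ)) P) {Z : Matrix (Fin p) (Fin p) ℂ} (hZ : Z ∈ siegelUpperHalfSpace (Fin p))
    {W : Matrix (Fin q) (Fin q) ℂ} (hW : W ∈ siegelUpperHalfSpace (Fin q)) (x : Fin l → Fin p → ℂ)
    (y : Fin l → Fin q → ℂ) :
    polyDiff (blockVec x y) P (weightFun k s g) (Matrix.fromBlocks Z 0 0 W) =
      weightFun k s g (Matrix.fromBlocks Z 0 0 W) *
        MvPolynomial.eval (linkValue (bigDelta_sub_bigE_isSymm hg (blockDiag_isSymm hZ.1 hW.1)) (blockVec x y))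
          (MvPolynomial.map (Polynomial.evalRingHom s) (pullbackPolynomial l k P)) := by
  rw [polyDiff_weightFun (l := l) (by simp [two_mul]) _ k s hg hP (fromBlocks_mem_siegelUpperHalfSpace hZ hW),
    eval_pullbackPolynomial]
  set Z₀ := Matrix.fromBlocks Z 0 0 W with hZ₀
  -- Shifting both colours by `-E/2` turns the covariances `-Δ/2`, `-E/2` into `-(Δ - E)/2`, `0`.
  have hsplit : covariance (blockVec x y) (fun c => colorMatrix g c Z₀) =
      (fun c u => if c then -(1 / 2) * linkValue (bigDelta_sub_bigE_isSymm hg (blockDiag_isSymm hZ.1 hW.1))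
        (blockVec x y) u else 0) + fun _ u => -(1 / 2) * linkForm (blockVec x y) u (bigE Z₀) := by
    funext c u
    cases c
    · simp [covariance, colorMatrix]
    · simp only [covariance, colorMatrix, Pi.add_apply, if_true, linkValue_eq_linkForm, map_sub]
      ring
  have hzero : heat (dims k s) (fun _ u => -(1 / 2) * linkForm (blockVec x y) u (bigE Z₀)) (colorSum Bool P) = 0 := by
    refine heat_colorSum_eq_zero (dims k s) hP ?_ _ fun a b => ?_
    · rwa [Fintype.sum_bool, dims, dims, show 2 * (k : ℂ) + 2 * s + -2 * s = 2 * k by ring]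
    · rw [hZ₀, bigE_fromBlocks hZ hW, linkForm_fromBlocks_cross, mul_zero]
  rw [hsplit, expectation_add_of_heat_eq_zero _ _ _ hzero]

end Pullback

end

end SiegelPullback

theorem proposition4p2 (l : ℕ) (k : ℤ) (P : MvPolynomial (Sym2 (Fin l ⊕ Fin l)) ℂ)
    (hP : SiegelPullback.IsHomogeneousOn Set.univ P)
    (hharm : SiegelPullback.IsPluriharmonic (2 * (k : ℂ)) P) :
    ∃ Q : MvPolynomial (Sym2 (Fin l ⊕ Fin l)) (Polynomial ℂ),
      SiegelPullback.IsHomogeneousOn Set.univ Q ∧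
      ∀ (p q : ℕ) (s : ℂ)
        (g : Matrix ((Fin p ⊕ Fin q) ⊕ (Fin p ⊕ Fin q)) ((Fin p ⊕ Fin q) ⊕ (Fin p ⊕ Fin q)) ℝ)
        (hg : g ∈ Matrix.symplecticGroup (Fin p ⊕ Fin q) ℝ)
        (Z : Matrix (Fin p) (Fin p) ℂ) (hZ : Z ∈ SiegelPullback.siegelUpperHalfSpace (Fin p))
        (W : Matrix (Fin q) (Fin q) ℂ) (hW : W ∈ SiegelPullback.siegelUpperHalfSpace (Fin q))
        (x : Fin l → Fin p → ℂ) (y : Fin l → Fin q → ℂ),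
        SiegelPullback.polyDiff (SiegelPullback.blockVec x y) P
            (SiegelPullback.weightFun k s g) (Matrix.fromBlocks Z 0 0 W) =
          SiegelPullback.weightFun k s g (Matrix.fromBlocks Z 0 0 W) *
            MvPolynomial.eval
              (SiegelPullback.linkValue
                (SiegelPullback.bigDelta_sub_bigE_isSymm hg
                  (SiegelPullback.blockDiag_isSymm hZ.1 hW.1))
                (SiegelPullback.blockVec x y))
              (MvPolynomial.map (Polynomial.evalRingHom s) Q) := by
  have hP' := SiegelPullback.isWeightedHomogeneous_of_isHomogeneousOn hP
  exact ⟨SiegelPullback.pullbackPolynomial l k P,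
    SiegelPullback.isHomogeneousOn_of_isWeightedHomogeneous
      (SiegelPullback.pullbackPolynomial_isWeightedHomogeneous l k hP'),
    fun p q s g hg Z hZ W hW x y => SiegelPullback.polyDiff_weightFun_fromBlocks k s hg hP' hharm hZ hW x y⟩
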